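/- Consider one leader (index $0$) and $n\ge 1$ followers with states $x^i_t\in\mathbb{R}^{d_x}$, actions $u^i_t\in\mathbb{R}^{d_u}$, $t=1,2,\dots$, mean-field $\bar x_t=\frac1n\sum_{i=1}^n x^i_t$, and time-homogeneous dynamics $$x^0_{t+1}=A^0x^0_t+B^0u^0_t+D^0\bar x_t+w^0_t,\qquad x^i_{t+1}=Ax^i_t+Bu^i_t+D\bar x_t+Ex^0_t+w^i_t\quad(1\le i\le n).$$ The joint initial state $(x^i_1)_{i=0}^n$ and the joint noise vectors $(w^i_t)_{i=0}^n$, $t\ge1$, are square-integrable and mutually independent (over time; at a fixed time the agents' components may be dependent), and the noise has mean zero. A strategy consists of measurable functions $u^0_t=g^0_t(x^0_t,\bar x_t)$ and $u^i_t=g^i_t(x^i_t,\bar x_t,x^0_t)$, $1\le i\le n$, $t\ge 1$. For $\beta\in(0,1]$ its cost is $$J_\infty=\mathbb{E}\Big[\sum_{t=1}^\infty\beta^{t-1}\Big((x^0_t)^\intercal Q^0x^0_t+(u^0_t)^\intercal R^0u^0_t+\frac1n\sum_{i=1}^n\big((x^i_t)^\intercal Qx^i_t+(x^i_t-x^0_t)^\intercal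 P(x^i_t-x^0_t)+(u^i_t)^\intercal Ru^i_t\big)+\frac1{2n^2}\sum_{i,j=1}^n(x^i_t-x^j_t)^\intercal H(x^i_t-x^j_t)\Big)\Big]\in[0,\infty],$$ with symmetric weight matrices. Put $$\bar A=\begin{bmatrix}A^0&D^0\\E&A+D\end{bmatrix},\quad \bar B=\begin{bmatrix}B^0&0\\0&B\end{bmatrix},\quad \bar Q=\begin{bmatrix}Q^0+P&-P\\-P&Q+P\end{bmatrix},\quad \bar R=\begin{bmatrix}R^0&0\\0&R\end{bmatrix}.$$ Assume that $Q+P+H$ and $\bar Q$ are positive semi-definite, that $R^0$ and $R$ are positive definite, that $(\sqrt\beta A,\sqrt\beta B)$ and $(\sqrt\beta\bar A,\sqrt\beta\bar B)$ are stabilizable, and that $(\sqrt\beta A,(Q+P+H)^{1/2})$ and $(\sqrt\beta\bar A,\bar Q^{1/2})$ are detectable. Then the two algebraic Riccati equations (whose sizes $d_x$ and $2d_x$ do not depend on $n$) $$\breve M=-\beta A^\intercal\breve MB(B^\intercal\breve MB+\beta^{-1}R)^{-1}B^\intercal\breve MA+\beta A^\intercal\breve MA+Q+P+H,$$ $$\bar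 M=-\beta\bar A^\intercal\bar M\bar B(\bar B^\intercal\bar M\bar B+\beta^{-1}\bar R)^{-1}\bar B^\intercal\bar M\bar A+\beta\bar A^\intercal\bar M\bar A+\bar Q$$ have positive semi-definite solutions, and for any such solutions $\breve M,\bar M$, with the gains $$\breve L=-(B^\intercal\breve MB+\beta^{-1}R)^{-1}B^\intercal\breve MA,\qquad \bar L=\begin{bmatrix}\bar L^{1,1}&\bar L^{1,2}\\\bar L^{2,1}&\bar L^{2,2}\end{bmatrix}=-(\bar B^\intercal\bar M\bar B+\beta^{-1}\bar R)^{-1}\bar B^\intercal\bar M\bar A,$$ the stationary linear strategy $$u^0_t=\bar L^{1,1}x^0_t+\bar L^{1,2}\bar x_t,\qquad u^i_t=\breve Lx^i_t+\bar L^{2,1}x^0_t+(\bar L^{2,2}-\breve L)\bar x_t$$ is optimal: it minimizes $J_\infty$ over all strategies. -/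

import Mathlib

open MeasureTheory ProbabilityTheory
open scoped Matrix MatrixOrder ENNReal

noncomputable section

namespace LeaderFollower

/-- A square real matrix is (Schur) stable: its complex eigenvalues lie in the open unit disc. -/
def SchurStable {ι : Type*} [Fintype ι] [DecidableEq ι] (F : Matrix ι ι ℝ) : Prop :=
  ∀ z ∈ spectrum ℂ (F.map Complex.ofReal), ‖z‖ < 1

/-- `(F, G)` is stabilizable: some state feedback `u = K x` makes `F + G K` stable. -/
def Stabilizable {ι κ : Type*} [Fintype ι] [DecidableEq ι] [Fintype κ]
    (F : Matrix ι ι ℝ) (G : Matrix ι κ ℝ) : Prop :=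
  ∃ K : Matrix κ ι ℝ, SchurStable (F + G * K)

/-- `(F, C)` is detectable: some output injection `K` makes `F + K C` stable. -/
def Detectable {ι κ : Type*} [Fintype ι] [DecidableEq ι] [Fintype κ]
    (F : Matrix ι ι ℝ) (C : Matrix κ ι ℝ) : Prop :=
  ∃ K : Matrix ι κ ℝ, SchurStable (F + K * C)

/-- `M` is a positive semi-definite solution of the discounted algebraic Riccati equation
`M = -β Fᵀ M G (Gᵀ M G + β⁻¹ S)⁻¹ Gᵀ M F + β Fᵀ M F + W`. -/
def SolvesRiccati {ι κ : Type*} [Fintype ι] [Fintype κ] [DecidableEq κ] (β : ℝ)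
    (F : Matrix ι ι ℝ) (G : Matrix ι κ ℝ) (W : Matrix ι ι ℝ) (S : Matrix κ κ ℝ)
    (M : Matrix ι ι ℝ) : Prop :=
  M.PosSemidef ∧
    M = -(β • (Fᵀ * M * G * (Gᵀ * M * G + β⁻¹ • S)⁻¹ * Gᵀ * M * F)) + β • (Fᵀ * M * F) + W

/-- The feedback gain `-(Gᵀ M G + β⁻¹ S)⁻¹ Gᵀ M F` attached to `M`. -/
def riccatiGain {ι κ : Type*} [Fintype ι] [Fintype κ] [DecidableEq κ] (β : ℝ)
    (F : Matrix ι ι ℝ) (G : Matrix ι κ ℝ) (S : Matrix κ κ ℝ) (M : Matrix ι ι ℝ) :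
    Matrix κ ι ℝ :=
  -((Gᵀ * M * G + β⁻¹ • S)⁻¹ * Gᵀ * M * F)

/-- The time-homogeneous data of a leader-follower network: the leader's dynamics
`A0, B0, D0`, the followers' dynamics `A, B, D, E`, and the cost weights. -/
structure Model (dx du : ℕ) where
  A0 : Matrix (Fin dx) (Fin dx) ℝ
  B0 : Matrix (Fin dx) (Fin du) ℝ
  D0 : Matrix (Fin dx) (Fin dx) ℝ
  A : Matrix (Fin dx) (Fin dx) ℝ
  B : Matrix (Fin dx) (Fin du) ℝ
  D : Matrix (Fin dx) (Fin dx) ℝ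
  E : Matrix (Fin dx) (Fin dx) ℝ
  Q0 : Matrix (Fin dx) (Fin dx) ℝ
  R0 : Matrix (Fin du) (Fin du) ℝ
  Q : Matrix (Fin dx) (Fin dx) ℝ
  P : Matrix (Fin dx) (Fin dx) ℝ
  R : Matrix (Fin du) (Fin du) ℝ
  H : Matrix (Fin dx) (Fin dx) ℝ

/-- A joint vector: the entry `0` belongs to the leader, the entry `i.succ` to follower `i`. -/
abbrev Joint (n d : ℕ) : Type := Fin (n + 1) → Fin d → ℝ

/-- The average of the followers' entries of a joint vector. -/
def meanField {n d : ℕ} (x : Joint n d) : Fin d → ℝ := (n : ℝ)⁻¹ • ∑ i : Fin n, x i.succ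

/-- The quadratic form `vᵀ W v`. -/
def quad {d : ℕ} (W : Matrix (Fin d) (Fin d) ℝ) (v : Fin d → ℝ) : ℝ := v ⬝ᵥ (W *ᵥ v)

namespace Model

variable {dx du : ℕ} (m : Model dx du)

def Abar : Matrix (Fin dx ⊕ Fin dx) (Fin dx ⊕ Fin dx) ℝ :=
  Matrix.fromBlocks m.A0 m.D0 m.E (m.A + m.D)

def Bbar : Matrix (Fin dx ⊕ Fin dx) (Fin du ⊕ Fin du) ℝ :=
  Matrix.fromBlocks m.B0 0 0 m.B

def Qbar : Matrix (Fin dx ⊕ Fin dx) (Fin dx ⊕ Fin dx) ℝ :=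
  Matrix.fromBlocks (m.Q0 + m.P) (-m.P) (-m.P) (m.Q + m.P)

def Rbar : Matrix (Fin du ⊕ Fin du) (Fin du ⊕ Fin du) ℝ :=
  Matrix.fromBlocks m.R0 0 0 m.R

/-- One step of the coupled dynamics of the leader and the followers. -/
def step {n : ℕ} (x : Joint n dx) (u : Joint n du) (w : Joint n dx) : Joint n dx :=
  Fin.cons (m.A0 *ᵥ x 0 + m.B0 *ᵥ u 0 + m.D0 *ᵥ meanField x + w 0)
    (fun i : Fin n => m.A *ᵥ x i.succ + m.B *ᵥ u i.succ + m.D *ᵥ meanField x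
      + m.E *ᵥ x 0 + w i.succ)

/-- The (undiscounted) cost of one stage. -/
def stageCost {n : ℕ} (x : Joint n dx) (u : Joint n du) : ℝ :=
  quad m.Q0 (x 0) + quad m.R0 (u 0)
    + 1 / (n : ℝ) * ∑ i : Fin n,
        (quad m.Q (x i.succ) + quad m.P (x i.succ - x 0) + quad m.R (u i.succ))
    + 1 / (2 * (n : ℝ) ^ 2) * ∑ i : Fin n, ∑ j : Fin n, quad m.H (x i.succ - x j.succ)

end Model

/-- A distributed control strategy, possibly time-varying, nonlinear, and different from
agent to agent: the leader's action is a measurable function of its state and the mean-field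
`(x⁰, x̄)`, the action of follower `i` is a measurable function of `(xⁱ, x̄, x⁰)`. -/
structure Strategy (n dx du : ℕ) where
  leader : ℕ → (Fin dx → ℝ) × (Fin dx → ℝ) → (Fin du → ℝ)
  follower : ℕ → Fin n → (Fin dx → ℝ) × (Fin dx → ℝ) × (Fin dx → ℝ) → (Fin du → ℝ)
  measurable_leader : ∀ t, Measurable (leader t)
  measurable_follower : ∀ t i, Measurable (follower t i)

/-- The joint action that a strategy prescribes at time `t` in the joint state `x`. -/
def Strategy.action {n dx du : ℕ} (g : Strategy n dx du) (t : ℕ) (x : Joint n dx) :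
    Joint n du :=
  Fin.cons (g.leader t (x 0, meanField x))
    (fun i : Fin n => g.follower t i (x i.succ, meanField x, x 0))

namespace Model

variable {n dx du : ℕ} (m : Model dx du)

/-- The state trajectory under the strategy `g`, for one realization of the initial state `x₁`
and of the noise `w`. Times are counted from `0`. -/
def trajectory (g : Strategy n dx du) (x₁ : Joint n dx) (w : ℕ → Joint n dx) :
    ℕ → Joint n dx
  | 0 => x₁
  | t + 1 => m.step (trajectory g x₁ w t) (g.action t (trajectory g x₁ w t)) (w t)

/-- The expected infinite-horizon cost with discount factor `β`, as an extended nonnegative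
number. Where the stage costs are nonnegative, as they are under the definiteness conditions on
the weights, no information is lost by `ENNReal.ofReal`. -/
def cost {Ω : Type*} [MeasurableSpace Ω] (μ : Measure Ω) (β : ℝ) (x₁ : Ω → Joint n dx)
    (w : ℕ → Ω → Joint n dx) (g : Strategy n dx du) : ℝ≥0∞ :=
  ∫⁻ ω, ∑' t : ℕ, ENNReal.ofReal (β ^ t *
    m.stageCost (m.trajectory g (x₁ ω) (fun s => w s ω) t)
      (g.action t (m.trajectory g (x₁ ω) (fun s => w s ω) t))) ∂μ

/-- `g` minimizes the infinite-horizon cost over all distributed strategies. -/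
def IsOptimal {Ω : Type*} [MeasurableSpace Ω] (μ : Measure Ω) (β : ℝ) (x₁ : Ω → Joint n dx)
    (w : ℕ → Ω → Joint n dx) (g : Strategy n dx du) : Prop :=
  ∀ g' : Strategy n dx du, m.cost μ β x₁ w g ≤ m.cost μ β x₁ w g'

end Model

/-- The stationary linear strategy `u⁰ = L̄¹¹ x⁰ + L̄¹² x̄`,
`uⁱ = L̆ xⁱ + L̄²¹ x⁰ + (L̄²² - L̆) x̄` with gains `L̆` (`Lb`) and `L̄` (`Lbar`). -/
def linearStrategy (n : ℕ) {dx du : ℕ} (Lb : Matrix (Fin du) (Fin dx) ℝ)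
    (Lbar : Matrix (Fin du ⊕ Fin du) (Fin dx ⊕ Fin dx) ℝ) : Strategy n dx du where
  leader _ p := Lbar.toBlocks₁₁ *ᵥ p.1 + Lbar.toBlocks₁₂ *ᵥ p.2
  follower _ _ p :=
    Lb *ᵥ p.1 + Lbar.toBlocks₂₁ *ᵥ p.2.2 + (Lbar.toBlocks₂₂ - Lb) *ᵥ p.2.1
  measurable_leader _ := by
    apply Continuous.measurable
    fun_prop
  measurable_follower _ _ := by
    apply Continuous.measurable
    fun_prop

/-- The primitive random vectors, listed in time: the joint initial state, then the joint noise
vectors of the successive times. -/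
def primitives {n d : ℕ} {Ω : Type*} (x₁ : Ω → Joint n d) (w : ℕ → Ω → Joint n d) :
    ℕ → Ω → Joint n d
  | 0 => x₁
  | t + 1 => w t

end LeaderFollower

end

/-!
The deviations `xⁱ - x̄` of the followers from the mean-field and the pair `(x⁰, x̄)` of leader and
mean-field follow linear systems of their own, `(A, B)` and `(Ā, B̄)`, whatever the strategy
(`deviation_step`, `leaderMean_step`). Since the deviations sum to zero, the stage cost is the sum of
a quadratic cost of the pair and the average of quadratic costs of the deviations
(`stageCost_eq`), and the linear strategy is exactly the feedback that applies each Riccati gain in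
its own system. So everything reduces to one linear-quadratic system at a time.

For such a system, value iteration `Mₖ₊₁ = Ric Mₖ`, `M₀ = 0`, is monotone; stabilizability bounds
it, and its limit is a positive semi-definite solution of the Riccati equation
(`Stabilizable.exists_tendsto_valueIter`). Every solution `M` dominates `Mₖ`; conversely, along the
closed loop of the limit solution the stage costs are summable, so that detectability drives the
state to zero and `M` is dominated by the limit. Hence `Mₖ` converges to any given
solution (`tendsto_qform_valueIter`). The analytic ingredient is Gelfand's formula, which turns the
spectral definition of stability into geometric decay (`SchurStable.exists_pow_le`).

Completion of the square (`qform_stage_add_eq`) gives, for every strategy of finite cost, the lower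
bound `E ⟨X₀, M_N X₀⟩ + ∑_{t<N} β^(t+1) E ⟨ξ_t, M_{N-1-t} ξ_t⟩` on the cost of `N` stages, where `ξ`
is the noise. The Riccati feedback pays for its first `T` stages at most
`E ⟨X₀, M X₀⟩ + ∑_{t<T} β^(t+1) E ⟨ξ_t, M ξ_t⟩`, which is the limit as `N → ∞` of the lower bound
truncated to the noise of the first `T` stages. This comparison
(`IsNoisyRun.exists_tendsto_le_sum_integral_cost`) needs no transversality condition, hence covers
noise of arbitrary growth and costs that may be infinite. The cross terms between state and noise
vanish by independence, once the states are known to be square-integrable; for a strategy of finite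
cost this follows from the positive definiteness of the action weights.
-/

namespace LeaderFollower
open Filter Topology Matrix

/-! ### Powers of Schur stable matrices -/

section Schur

attribute [local instance] Matrix.linftyOpNormedRing Matrix.linftyOpNormedAlgebra
  Matrix.linftyOpNormedAddCommGroup

variable {ι κ : Type*} [Fintype ι] [DecidableEq ι] [Fintype κ]

lemma linfty_opNorm_map_ofReal (M : Matrix ι ι ℝ) : ‖M.map Complex.ofReal‖ = ‖M‖ := by
  simp [Matrix.linfty_opNorm_def]

/-- Gelfand's formula over `ℂ`: the powers of a Schur stable matrix decay geometrically. -/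
lemma SchurStable.exists_pow_le {F : Matrix ι ι ℝ} (h : SchurStable F) :
    ∃ C r : ℝ, 0 ≤ C ∧ 0 ≤ r ∧ r < 1 ∧ ∀ (k : ℕ) (x : ι → ℝ),
      ‖(F ^ k) *ᵥ x‖ ≤ C * r ^ k * ‖x‖ := by
  suffices H : ∃ C r : ℝ, 0 ≤ C ∧ 0 ≤ r ∧ r < 1 ∧ ∀ k : ℕ, ‖F ^ k‖ ≤ C * r ^ k by
    obtain ⟨C, r, hC, hr, hr1, H⟩ := H
    exact ⟨C, r, hC, hr, hr1, fun k x => (Matrix.linfty_opNorm_mulVec _ _).trans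
      (mul_le_mul_of_nonneg_right (H k) (norm_nonneg _))⟩
  cases isEmpty_or_nonempty ι
  · refine ⟨0, 0, le_rfl, le_rfl, one_pos, fun k => ?_⟩
    rw [Subsingleton.elim (F ^ k) 0]
    simp
  have hrad : spectralRadius ℂ (F.map Complex.ofReal) < ((1 : NNReal) : ℝ≥0∞) :=
    spectrum.spectralRadius_lt_of_forall_lt _ fun z hz => by
      have := h z hz
      exact_mod_cast this
  obtain ⟨r, hr0, hr1⟩ := ENNReal.lt_iff_exists_nnreal_btwn.1 hrad
  have hr1' : (r : ℝ) < 1 := by exact_mod_cast hr1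
  have hev := (spectrum.pow_nnnorm_pow_one_div_tendsto_nhds_spectralRadius
    (F.map Complex.ofReal)).eventually (gt_mem_nhds hr0)
  obtain ⟨N, hN⟩ := eventually_atTop.1 (hev.and (eventually_gt_atTop 0))
  have hpow : ∀ k, N ≤ k → ‖F ^ k‖ ≤ (r : ℝ) ^ k := by
    intro k hk
    obtain ⟨h1, h2⟩ := hN k hk
    have h3 : (‖F.map Complex.ofReal ^ k‖₊ : ℝ≥0∞) ≤ (r : ℝ≥0∞) ^ k := by
      have h4 := ENNReal.rpow_le_rpow h1.le (Nat.cast_nonneg k : (0 : ℝ) ≤ k)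
      rwa [← ENNReal.rpow_mul, one_div, inv_mul_cancel₀ (by positivity), ENNReal.rpow_one,
        ENNReal.rpow_natCast] at h4
    have h5 : ‖F.map Complex.ofReal ^ k‖ ≤ (r : ℝ) ^ k := by exact_mod_cast h3
    have h6 : F.map Complex.ofReal ^ k = (F ^ k).map Complex.ofReal :=
      (map_pow (Complex.ofRealHom.mapMatrix) F k).symm
    rwa [h6, linfty_opNorm_map_ofReal] at h5
  rcases eq_or_ne r 0 with rfl | hrne
  · exact absurd hr0 (by simp)
  have hrpos : (0 : ℝ) < r := by
    have := pos_iff_ne_zero.2 hrne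
    exact_mod_cast this
  refine ⟨1 + ∑ k ∈ Finset.range N, ‖F ^ k‖ / (r : ℝ) ^ k, r, by positivity, r.2, hr1',
    fun k => ?_⟩
  have hs : 0 ≤ ∑ k ∈ Finset.range N, ‖F ^ k‖ / (r : ℝ) ^ k := by positivity
  rcases le_or_gt N k with hk | hk
  · exact (hpow k hk).trans (le_mul_of_one_le_left (by positivity) (by linarith))
  · rw [← div_le_iff₀ (by positivity)]
    have := Finset.single_le_sum (f := fun k => ‖F ^ k‖ / (r : ℝ) ^ k)
      (fun i _ => by positivity) (Finset.mem_range.2 hk)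
    linarith

lemma eq_pow_mulVec_add_sum {F : Matrix ι ι ℝ} {z f : ℕ → ι → ℝ}
    (hz : ∀ t, z (t + 1) = F *ᵥ z t + f t) (t : ℕ) :
    z t = (F ^ t) *ᵥ z 0 + ∑ s ∈ Finset.range t, (F ^ s) *ᵥ f (t - 1 - s) := by
  induction t with
  | zero => simp
  | succ t ih =>
    rw [hz, Finset.sum_range_succ', ih, mulVec_add, mulVec_mulVec, ← pow_succ', mulVec_sum]
    simp only [mulVec_mulVec, ← pow_succ', pow_zero, one_mulVec]
    rw [add_assoc]
    congr 2
    exact Finset.sum_congr rfl fun s hs => by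
      congr 2
      have := Finset.mem_range.1 hs
      omega

/-- A stable linear recursion driven by a vanishing input tends to zero. -/
lemma SchurStable.tendsto_zero {F : Matrix ι ι ℝ} (h : SchurStable F) {z f : ℕ → ι → ℝ}
    (hz : ∀ t, z (t + 1) = F *ᵥ z t + f t) (hf : Tendsto f atTop (𝓝 0)) :
    Tendsto z atTop (𝓝 0) := by
  obtain ⟨C, r, hC, hr, hr1, H⟩ := h.exists_pow_le
  obtain ⟨K, hK⟩ : ∃ K, ∀ t, ‖f t‖ ≤ K := by
    obtain ⟨K, hK⟩ := hf.norm.bddAbove_range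
    exact ⟨K, fun t => hK ⟨t, rfl⟩⟩
  have hpow := tendsto_pow_atTop_nhds_zero_of_lt_one hr hr1
  have h1 : Tendsto (fun t => (F ^ t) *ᵥ z 0) atTop (𝓝 0) := by
    refine squeeze_zero_norm (H · _) ?_
    simpa using (hpow.const_mul C).mul_const ‖z 0‖
  have h2 : Tendsto (fun t => ∑ s ∈ Finset.range t, (F ^ s) *ᵥ f (t - 1 - s)) atTop (𝓝 0) := by
    let G : ℕ → ℕ → ι → ℝ := fun t s => if s < t then (F ^ s) *ᵥ f (t - 1 - s) else 0
    have hG : ∀ t, ∑ s ∈ Finset.range t, (F ^ s) *ᵥ f (t - 1 - s) = ∑' s, G t s := by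
      intro t
      rw [tsum_eq_sum (s := Finset.range t) (by intro b hb; simp [G] at hb ⊢; omega)]
      exact Finset.sum_congr rfl fun s hs => by simp [G, Finset.mem_range.1 hs]
    simp_rw [hG]
    have := tendsto_tsum_of_dominated_convergence (𝓕 := atTop) (f := G) (g := fun _ => 0)
      (bound := fun s => C * r ^ s * K)
      (((summable_geometric_of_lt_one hr hr1).mul_left C).mul_right K) ?_ ?_
    · simpa using this
    · intro s
      have h3 : Tendsto (fun t => t - 1 - s) atTop atTop := by
        simp_rw [Nat.sub_sub]; exact tendsto_sub_atTop_nat _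
      have h4 := (hf.comp h3).norm.const_mul (C * r ^ s)
      refine squeeze_zero_norm (fun t => ?_) (by simpa using h4)
      by_cases hst : s < t
      · simpa [G, hst] using H s _
      · simp [G, hst]; positivity
    · refine Eventually.of_forall fun t s => ?_
      have hK0 : 0 ≤ K := (norm_nonneg _).trans (hK 0)
      by_cases hst : s < t
      · simp only [G, hst, if_true]
        exact (H s _).trans (mul_le_mul_of_nonneg_left (hK _) (by positivity))
      · simp [G, hst]; positivity
  rw [funext (eq_pow_mulVec_add_sum hz)]
  simpa using h1.add h2

end Schur

/-! ### Quadratic forms -/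

section QuadraticForms

lemma transpose_eq_of_posSemidef {ι : Type*} {M : Matrix ι ι ℝ} (h : M.PosSemidef) : Mᵀ = M := by
  simpa using h.isHermitian.eq

variable {ι κ : Type*} [Fintype ι] [Fintype κ]

/-- The quadratic form `xᵀ M x`, over an arbitrary finite index type. -/
def qform (M : Matrix ι ι ℝ) (x : ι → ℝ) : ℝ := x ⬝ᵥ M *ᵥ x

lemma qform_add_matrix (M N : Matrix ι ι ℝ) (x : ι → ℝ) :
    qform (M + N) x = qform M x + qform N x := by
  simp [qform, add_mulVec]

lemma qform_smul_matrix (c : ℝ) (M : Matrix ι ι ℝ) (x : ι → ℝ) :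
    qform (c • M) x = c * qform M x := by
  simp [qform, smul_mulVec]

lemma qform_neg_matrix (M : Matrix ι ι ℝ) (x : ι → ℝ) : qform (-M) x = -qform M x := by
  simp [qform, neg_mulVec]

@[simp] lemma qform_zero_matrix (x : ι → ℝ) : qform (0 : Matrix ι ι ℝ) x = 0 := by
  simp [qform]

lemma qform_smul (M : Matrix ι ι ℝ) (c : ℝ) (x : ι → ℝ) :
    qform M (c • x) = c ^ 2 * qform M x := by
  simp [qform, mulVec_smul]; ring

lemma qform_mulVec (M : Matrix ι ι ℝ) (K : Matrix ι κ ℝ) (x : κ → ℝ) :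
    qform M (K *ᵥ x) = qform (Kᵀ * M * K) x := by
  rw [qform, qform, ← mulVec_mulVec, ← mulVec_mulVec, dotProduct_mulVec x, vecMul_transpose]

lemma qform_add {M : Matrix ι ι ℝ} (hM : Mᵀ = M) (x y : ι → ℝ) :
    qform M (x + y) = qform M x + 2 * (x ⬝ᵥ M *ᵥ y) + qform M y := by
  have : y ⬝ᵥ M *ᵥ x = x ⬝ᵥ M *ᵥ y := by
    rw [dotProduct_mulVec, ← mulVec_transpose, hM, dotProduct_comm]
  simp only [qform, mulVec_add, dotProduct_add, add_dotProduct, this]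
  ring

lemma qform_eq_sum (M : Matrix ι ι ℝ) (x : ι → ℝ) :
    qform M x = ∑ i, ∑ j, M i j * (x i * x j) := by
  simp only [qform, dotProduct, mulVec, Finset.mul_sum]
  exact Finset.sum_congr rfl fun i _ => Finset.sum_congr rfl fun j _ => by ring

@[fun_prop] lemma continuous_qform (M : Matrix ι ι ℝ) : Continuous (qform M) := by
  unfold qform; fun_prop

lemma qform_nonneg {M : Matrix ι ι ℝ} (h : M.PosSemidef) (x : ι → ℝ) : 0 ≤ qform M x := by
  simpa [qform] using h.dotProduct_mulVec_nonneg x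

lemma posSemidef_of_qform_nonneg {M : Matrix ι ι ℝ} (h : Mᵀ = M) (h' : ∀ x, 0 ≤ qform M x) :
    M.PosSemidef :=
  .of_dotProduct_mulVec_nonneg (by simpa [IsHermitian] using h) fun x => by
    simpa [qform] using h' x

/-- Polarization: a symmetric matrix is read off from its quadratic form. -/
lemma apply_eq_qform [DecidableEq ι] {M : Matrix ι ι ℝ} (h : Mᵀ = M) (i j : ι) :
    M i j = (qform M (Pi.single i 1 + Pi.single j 1) - qform M (Pi.single i 1)
      - qform M (Pi.single j 1)) / 2 := by
  rw [qform_add h]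
  simp only [mulVec_single_one, single_one_dotProduct, col_apply]
  ring

/-- A quadratic form is bounded by a multiple of the squared sup norm. -/
lemma exists_abs_qform_le (M : Matrix ι ι ℝ) : ∃ C, 0 ≤ C ∧ ∀ x, |qform M x| ≤ C * ‖x‖ ^ 2 := by
  refine ⟨∑ i, ∑ j, |M i j|, by positivity, fun x => ?_⟩
  rw [qform_eq_sum, Finset.sum_mul]
  refine (Finset.abs_sum_le_sum_abs _ _).trans (Finset.sum_le_sum fun i _ => ?_)
  rw [Finset.sum_mul]
  refine (Finset.abs_sum_le_sum_abs _ _).trans (Finset.sum_le_sum fun j _ => ?_)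
  rw [abs_mul, abs_mul, sq]
  have h1 := norm_le_pi_norm x i
  have h2 := norm_le_pi_norm x j
  rw [Real.norm_eq_abs] at h1 h2
  gcongr

/-- A positive definite form is coercive. -/
lemma exists_pos_mul_sq_le_qform {S : Matrix ι ι ℝ} (hS : S.PosDef) :
    ∃ c, 0 < c ∧ ∀ x, c * ‖x‖ ^ 2 ≤ qform S x := by
  cases isEmpty_or_nonempty ι
  · exact ⟨1, one_pos, fun x => by simp [Subsingleton.elim x 0, qform]⟩
  have hne : (Metric.sphere (0 : ι → ℝ) 1).Nonempty := NormedSpace.sphere_nonempty.2 zero_le_one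
  obtain ⟨x₀, hx₀, hmin⟩ := (isCompact_sphere (0 : ι → ℝ) 1).exists_isMinOn hne
    (continuous_qform S).continuousOn
  have hx₀' : x₀ ≠ 0 := by rintro rfl; simp at hx₀
  refine ⟨qform S x₀, by simpa [qform] using hS.dotProduct_mulVec_pos hx₀', fun x => ?_⟩
  rcases eq_or_ne x 0 with rfl | hx
  · simp [qform]
  have hxn : ‖x‖ ≠ 0 := norm_ne_zero_iff.2 hx
  have h1 : qform S x₀ ≤ qform S (‖x‖⁻¹ • x) := hmin (by simp [norm_smul, hxn])
  rw [qform_smul, inv_pow, ← div_eq_inv_mul, le_div_iff₀ (by positivity)] at h1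
  exact h1

end QuadraticForms

/-! ### The Riccati operator and completion of the square -/

section Riccati

variable {ι κ : Type*} [Fintype ι] [Fintype κ]
  {β : ℝ} {F : Matrix ι ι ℝ} {G : Matrix ι κ ℝ} {W : Matrix ι ι ℝ} {S : Matrix κ κ ℝ}

lemma posDef_gain_denominator (hβ : 0 < β) (hS : S.PosDef) {M : Matrix ι ι ℝ}
    (hM : M.PosSemidef) : (Gᵀ * M * G + β⁻¹ • S).PosDef := by
  have h := hM.conjTranspose_mul_mul_same G
  rw [conjTranspose_eq_transpose_of_trivial] at h
  exact PosDef.posSemidef_add h (hS.smul (inv_pos.2 hβ))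

/-- The discounted one-step cost of the next state in terms of the scaled dynamics. -/
lemma mul_qform_eq_sqrt_smul (hβ : 0 < β) (M : Matrix ι ι ℝ) (K : Matrix κ ι ℝ) (x : ι → ℝ) :
    β * qform M (F *ᵥ x + G *ᵥ K *ᵥ x) = qform M ((√β • F + √β • G * K) *ᵥ x) := by
  rw [show (√β • F + √β • G * K) *ᵥ x = √β • (F *ᵥ x + G *ᵥ K *ᵥ x) by
    rw [Matrix.smul_mul, ← smul_add, smul_mulVec, add_mulVec, mulVec_mulVec], qform_smul,
    Real.sq_sqrt hβ.le]

variable [DecidableEq κ]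

/-- The right-hand side of the discounted algebraic Riccati equation. -/
noncomputable def riccatiOp (β : ℝ) (F : Matrix ι ι ℝ) (G : Matrix ι κ ℝ) (W : Matrix ι ι ℝ)
    (S : Matrix κ κ ℝ) (M : Matrix ι ι ℝ) : Matrix ι ι ℝ :=
  -(β • (Fᵀ * M * G * (Gᵀ * M * G + β⁻¹ • S)⁻¹ * Gᵀ * M * F)) + β • (Fᵀ * M * F) + W

/-- Completion of the square: the one-stage cost plus the discounted value of the next state is
the value of the Riccati image, plus a nonnegative term that vanishes for the gain feedback. -/
lemma qform_stage_add_eq (hβ : 0 < β) (hS : S.PosDef) {M : Matrix ι ι ℝ} (hM : M.PosSemidef)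
    (x : ι → ℝ) (u : κ → ℝ) :
    qform W x + qform S u + β * qform M (F *ᵥ x + G *ᵥ u) =
      qform (riccatiOp β F G W S M) x
        + β * qform (Gᵀ * M * G + β⁻¹ • S) (u - riccatiGain β F G S M *ᵥ x) := by
  have hMt := transpose_eq_of_posSemidef hM
  have hN := posDef_gain_denominator (G := G) hβ hS hM
  have hNt := transpose_eq_of_posSemidef hN.posSemidef
  set N := Gᵀ * M * G + β⁻¹ • S with hNdef
  have hNL : N * riccatiGain β F G S M = -(Gᵀ * M * F) := by
    rw [riccatiGain, ← hNdef, Matrix.mul_neg, Matrix.mul_assoc, Matrix.mul_assoc, ← Matrix.mul_assoc N,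
      mul_nonsing_inv _ ((isUnit_iff_isUnit_det _).1 hN.isUnit), Matrix.one_mul, Matrix.mul_assoc]
  have hLNL : (riccatiGain β F G S M)ᵀ * N * riccatiGain β F G S M =
      Fᵀ * M * G * N⁻¹ * Gᵀ * M * F := by
    rw [Matrix.mul_assoc, hNL, riccatiGain, ← hNdef]
    simp only [transpose_neg, transpose_mul, transpose_transpose, transpose_nonsing_inv, hMt, hNt,
      Matrix.neg_mul, Matrix.mul_neg, neg_neg, Matrix.mul_assoc]
  have hcross : u ⬝ᵥ N *ᵥ riccatiGain β F G S M *ᵥ x = -(G *ᵥ u ⬝ᵥ M *ᵥ F *ᵥ x) := by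
    rw [mulVec_mulVec, hNL, neg_mulVec, dotProduct_neg, ← mulVec_mulVec, ← mulVec_mulVec,
      dotProduct_mulVec, vecMul_transpose]
  rw [sub_eq_add_neg, qform_add hNt, mulVec_neg, dotProduct_neg, hcross,
    show -(riccatiGain β F G S M *ᵥ x) = (-1 : ℝ) • (riccatiGain β F G S M *ᵥ x) by simp,
    qform_smul, qform_mulVec, hLNL, add_comm (F *ᵥ x), qform_add hMt, riccatiOp, ← hNdef]
  simp only [qform_add_matrix, qform_neg_matrix, qform_smul_matrix, hNdef, qform_mulVec]
  field_simp
  ring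

lemma qform_riccatiOp_le (hβ : 0 < β) (hS : S.PosDef) {M : Matrix ι ι ℝ} (hM : M.PosSemidef)
    (x : ι → ℝ) (u : κ → ℝ) :
    qform (riccatiOp β F G W S M) x ≤
      qform W x + qform S u + β * qform M (F *ᵥ x + G *ᵥ u) := by
  rw [qform_stage_add_eq hβ hS hM]
  have := qform_nonneg (posDef_gain_denominator (G := G) hβ hS hM).posSemidef
    (u - riccatiGain β F G S M *ᵥ x)
  have := mul_nonneg hβ.le this
  linarith

lemma qform_riccatiOp_eq (hβ : 0 < β) (hS : S.PosDef) {M : Matrix ι ι ℝ} (hM : M.PosSemidef)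
    (x : ι → ℝ) :
    qform (riccatiOp β F G W S M) x =
      qform W x + qform S (riccatiGain β F G S M *ᵥ x)
        + β * qform M (F *ᵥ x + G *ᵥ riccatiGain β F G S M *ᵥ x) := by
  rw [qform_stage_add_eq hβ hS hM]
  simp [qform]

lemma riccatiOp_posSemidef (hβ : 0 < β) (hW : W.PosSemidef) (hS : S.PosDef)
    {M : Matrix ι ι ℝ} (hM : M.PosSemidef) : (riccatiOp β F G W S M).PosSemidef := by
  refine posSemidef_of_qform_nonneg ?_ fun x => ?_
  · have hN := transpose_eq_of_posSemidef (posDef_gain_denominator (G := G) hβ hS hM).posSemidef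
    simp only [riccatiOp, transpose_add, transpose_neg, transpose_smul, transpose_mul,
      transpose_transpose, transpose_nonsing_inv, transpose_eq_of_posSemidef hM,
      transpose_eq_of_posSemidef hW, Matrix.mul_assoc]
    simp only [transpose_eq_of_posSemidef hS.posSemidef]
  · rw [qform_riccatiOp_eq hβ hS hM]
    have h1 := qform_nonneg hW x
    have h2 := qform_nonneg hS.posSemidef (riccatiGain β F G S M *ᵥ x)
    have h3 := mul_nonneg hβ.le
      (qform_nonneg hM (F *ᵥ x + G *ᵥ riccatiGain β F G S M *ᵥ x))
    linarith

lemma qform_riccatiOp_mono (hβ : 0 < β) (hS : S.PosDef) {M M' : Matrix ι ι ℝ}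
    (hM : M.PosSemidef) (hM' : M'.PosSemidef) (h : ∀ x, qform M x ≤ qform M' x) (x : ι → ℝ) :
    qform (riccatiOp β F G W S M) x ≤ qform (riccatiOp β F G W S M') x := by
  rw [qform_riccatiOp_eq hβ hS hM']
  refine (qform_riccatiOp_le hβ hS hM x (riccatiGain β F G S M' *ᵥ x)).trans ?_
  gcongr
  exact h _

/-- The Riccati operator is continuous at positive semi-definite matrices, where the matrix to be
inverted is invertible. -/
lemma continuousAt_riccatiOp (hβ : 0 < β) (hS : S.PosDef) {M : Matrix ι ι ℝ}
    (hM : M.PosSemidef) : ContinuousAt (riccatiOp β F G W S) M := by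
  have hN := (posDef_gain_denominator (G := G) hβ hS hM).isUnit
  have h1 : ContinuousAt (fun M : Matrix ι ι ℝ => (Gᵀ * M * G + β⁻¹ • S)⁻¹) M := by
    have hdet := (isUnit_iff_isUnit_det _).1 hN
    have h2 : ContinuousAt (Inv.inv : Matrix κ κ ℝ → Matrix κ κ ℝ) (Gᵀ * M * G + β⁻¹ • S) := by
      refine continuousAt_matrix_inv _ ?_
      rw [Ring.inverse_eq_inv']
      exact continuousAt_inv₀ hdet.ne_zero
    exact ContinuousAt.comp (f := fun M : Matrix ι ι ℝ => Gᵀ * M * G + β⁻¹ • S) h2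
      (by fun_prop)
  unfold riccatiOp
  fun_prop

/-! ### Value iteration -/

/-- The matrix of the optimal cost over `k` stages, with no terminal cost. -/
noncomputable def valueIter (β : ℝ) (F : Matrix ι ι ℝ) (G : Matrix ι κ ℝ) (W : Matrix ι ι ℝ)
    (S : Matrix κ κ ℝ) (k : ℕ) : Matrix ι ι ℝ :=
  (riccatiOp β F G W S)^[k] 0

lemma valueIter_succ (k : ℕ) :
    valueIter β F G W S (k + 1) = riccatiOp β F G W S (valueIter β F G W S k) :=
  Function.iterate_succ_apply' _ _ _

lemma valueIter_posSemidef (hβ : 0 < β) (hW : W.PosSemidef) (hS : S.PosDef) (k : ℕ) :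
    (valueIter β F G W S k).PosSemidef := by
  induction k with
  | zero => exact PosSemidef.zero
  | succ k ih => rw [valueIter_succ]; exact riccatiOp_posSemidef hβ hW hS ih

lemma monotone_qform_valueIter (hβ : 0 < β) (hW : W.PosSemidef) (hS : S.PosDef) (x : ι → ℝ) :
    Monotone fun k => qform (valueIter β F G W S k) x := by
  refine monotone_nat_of_le_succ fun k => ?_
  induction k generalizing x with
  | zero =>
    simpa [valueIter] using qform_nonneg (valueIter_posSemidef (F := F) (G := G) hβ hW hS 1) x
  | succ k ih =>
    rw [valueIter_succ, valueIter_succ]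
    exact qform_riccatiOp_mono hβ hS (valueIter_posSemidef hβ hW hS _)
      (valueIter_posSemidef hβ hW hS _) ih x

lemma qform_valueIter_le (hβ : 0 < β) (hW : W.PosSemidef) (hS : S.PosDef) {M : Matrix ι ι ℝ}
    (hM : SolvesRiccati β F G W S M) (k : ℕ) (x : ι → ℝ) :
    qform (valueIter β F G W S k) x ≤ qform M x := by
  induction k generalizing x with
  | zero => simpa [valueIter] using qform_nonneg hM.1 x
  | succ k ih =>
    rw [valueIter_succ, show M = riccatiOp β F G W S M from hM.2]
    exact qform_riccatiOp_mono hβ hS (valueIter_posSemidef hβ hW hS _) hM.1 ih x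

variable [DecidableEq ι]

/-- A stabilizing feedback has finite cost, which bounds value iteration. -/
lemma Stabilizable.bddAbove_qform_valueIter (hβ : 0 < β) (hW : W.PosSemidef) (hS : S.PosDef)
    (h : Stabilizable (√β • F) (√β • G)) (x : ι → ℝ) :
    BddAbove (Set.range fun k => qform (valueIter β F G W S k) x) := by
  obtain ⟨K, hK⟩ := h
  set Φ := √β • F + √β • G * K with hΦ
  obtain ⟨C, r, hC, hr, hr1, H⟩ := hK.exists_pow_le
  obtain ⟨D, hD, hDle⟩ := exists_abs_qform_le (W + Kᵀ * S * K)
  have hr2 : r ^ 2 < 1 := by nlinarith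
  have hbound : ∀ (t : ℕ), qform (W + Kᵀ * S * K) (Φ ^ t *ᵥ x) ≤
      D * (C * ‖x‖) ^ 2 * (r ^ 2) ^ t := by
    intro t
    refine (le_abs_self _).trans ((hDle _).trans ?_)
    calc D * ‖Φ ^ t *ᵥ x‖ ^ 2 ≤ D * (C * r ^ t * ‖x‖) ^ 2 := by gcongr; exact H t x
      _ = _ := by ring
  have hle : ∀ (k : ℕ) (x : ι → ℝ), qform (valueIter β F G W S k) x ≤
      ∑ t ∈ Finset.range k, qform (W + Kᵀ * S * K) (Φ ^ t *ᵥ x) := by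
    intro k
    induction k with
    | zero => intro x; simp [valueIter]
    | succ k ih =>
      intro x
      rw [valueIter_succ, Finset.sum_range_succ']
      refine (qform_riccatiOp_le hβ hS (valueIter_posSemidef hβ hW hS _) x (K *ᵥ x)).trans ?_
      rw [mul_qform_eq_sqrt_smul hβ, ← hΦ]
      have := ih (Φ *ᵥ x)
      simp only [mulVec_mulVec, ← pow_succ] at this
      simp only [pow_zero, one_mulVec, qform_add_matrix, qform_mulVec] at this ⊢
      linarith
  have hsum : Summable fun t : ℕ => D * (C * ‖x‖) ^ 2 * (r ^ 2) ^ t :=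
    (summable_geometric_of_lt_one (by positivity) hr2).mul_left _
  refine ⟨∑' t : ℕ, D * (C * ‖x‖) ^ 2 * (r ^ 2) ^ t, ?_⟩
  rintro _ ⟨k, rfl⟩
  exact (hle k x).trans ((Finset.sum_le_sum fun t _ => hbound t).trans
    (hsum.sum_le_tsum _ fun t _ => by positivity))

/-- Value iteration converges to a positive semi-definite solution of the Riccati equation. -/
lemma Stabilizable.exists_tendsto_valueIter (hβ : 0 < β) (hW : W.PosSemidef) (hS : S.PosDef)
    (h : Stabilizable (√β • F) (√β • G)) :
    ∃ M, SolvesRiccati β F G W S M ∧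
      ∀ x, Tendsto (fun k => qform (valueIter β F G W S k) x) atTop (𝓝 (qform M x)) := by
  choose v hv using fun x => (⟨_, tendsto_atTop_ciSup (monotone_qform_valueIter hβ hW hS x)
    (h.bddAbove_qform_valueIter hβ hW hS x)⟩ : ∃ l,
      Tendsto (fun k => qform (valueIter β F G W S k) x) atTop (𝓝 l))
  have hps := valueIter_posSemidef (F := F) (G := G) hβ hW hS
  obtain ⟨M, hM⟩ : ∃ M, Tendsto (valueIter β F G W S) atTop (𝓝 M) := by
    refine ⟨of fun i j => (v (Pi.single i 1 + Pi.single j 1) - v (Pi.single i 1)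
      - v (Pi.single j 1)) / 2, ?_⟩
    refine tendsto_pi_nhds.2 fun i => tendsto_pi_nhds.2 fun j => ?_
    simp_rw [apply_eq_qform (transpose_eq_of_posSemidef (hps _)) i j]
    exact (((hv _).sub (hv _)).sub (hv _)).div_const 2
  have hq : ∀ x, Tendsto (fun k => qform (valueIter β F G W S k) x) atTop (𝓝 (qform M x)) := by
    intro x
    have : Continuous fun M : Matrix ι ι ℝ => qform M x := by unfold qform; fun_prop
    exact (this.tendsto M).comp hM
  have hMps : M.PosSemidef := by
    refine posSemidef_of_qform_nonneg ?_ fun x =>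
      ge_of_tendsto' (hq x) fun k => qform_nonneg (hps k) x
    have hc : Continuous fun M : Matrix ι ι ℝ => Mᵀ := by fun_prop
    refine tendsto_nhds_unique ((hc.tendsto M).comp hM) (hM.congr fun k => ?_)
    exact (transpose_eq_of_posSemidef (hps k)).symm
  refine ⟨M, ⟨hMps, ?_⟩, hq⟩
  refine tendsto_nhds_unique (hM.comp (tendsto_add_atTop_nat 1))
    (((continuousAt_riccatiOp (F := F) (G := G) (W := W) hβ hS hMps).tendsto.comp hM).congr
      fun k => ?_)
  exact (valueIter_succ k).symm

/-- Under detectability, any positive semi-definite solution lies below any other: along the closed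
loop of the latter the stage costs are summable, hence the state tends to zero and the terminal
value of the former disappears. -/
lemma Detectable.qform_le_of_solvesRiccati (hβ : 0 < β) (hW : W.PosSemidef) (hS : S.PosDef)
    (h : Detectable (√β • F) (CFC.sqrt W)) {M M' : Matrix ι ι ℝ}
    (hM : SolvesRiccati β F G W S M) (hM' : SolvesRiccati β F G W S M') (x : ι → ℝ) :
    qform M x ≤ qform M' x := by
  obtain ⟨K, hK⟩ := h
  set L := riccatiGain β F G S M' with hL
  set Φ := √β • F + √β • G * L with hΦ
  set z : ℕ → ι → ℝ := fun t => Φ ^ t *ᵥ x with hz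
  have hzs : ∀ t, Φ *ᵥ z t = z (t + 1) := fun t => by simp [hz, mulVec_mulVec, pow_succ']
  set c : ℕ → ℝ := fun t => qform W (z t) + qform S (L *ᵥ z t) with hc
  have hW0 : ∀ t, 0 ≤ qform W (z t) := fun t => qform_nonneg hW _
  have hS0 : ∀ t, 0 ≤ qform S (L *ᵥ z t) := fun t => qform_nonneg hS.posSemidef _
  have heq : ∀ T, ∑ t ∈ Finset.range T, c t + qform M' (z T) = qform M' x := by
    intro T
    induction T with
    | zero => simp [hz]
    | succ T ih =>
      rw [Finset.sum_range_succ, ← ih]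
      have := qform_riccatiOp_eq (F := F) (G := G) (W := W) hβ hS hM'.1 (z T)
      rw [mul_qform_eq_sqrt_smul hβ, ← hL, ← hΦ, hzs,
        ← (show M' = riccatiOp β F G W S M' from hM'.2)] at this
      simp only [hc]
      linarith
  have hle : ∀ T, qform M x ≤ ∑ t ∈ Finset.range T, c t + qform M (z T) := by
    intro T
    induction T with
    | zero => simp [hz]
    | succ T ih =>
      refine ih.trans ?_
      rw [Finset.sum_range_succ]
      have := qform_riccatiOp_le (F := F) (G := G) (W := W) hβ hS hM.1 (z T) (L *ᵥ z T)
      rw [mul_qform_eq_sqrt_smul hβ, ← hΦ, hzs,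
        ← (show M = riccatiOp β F G W S M from hM.2)] at this
      simp only [hc]
      linarith
  have hc0 : Tendsto c atTop (𝓝 0) := by
    refine (summable_of_sum_range_le (c := qform M' x) (fun t => add_nonneg (hW0 t) (hS0 t))
      fun T => ?_).tendsto_atTop_zero
    have := heq T
    have := qform_nonneg hM'.1 (z T)
    simp only [hc] at *
    linarith
  have hL0 : Tendsto (fun t => L *ᵥ z t) atTop (𝓝 0) := by
    obtain ⟨a, ha, hle⟩ := exists_pos_mul_sq_le_qform hS
    have h1 : Tendsto (fun t => ‖L *ᵥ z t‖ ^ 2) atTop (𝓝 0) := by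
      refine squeeze_zero (fun t => by positivity) (fun t => ?_)
        (by simpa using hc0.const_mul a⁻¹)
      rw [← div_eq_inv_mul, le_div_iff₀ ha, mul_comm]
      have := hle (L *ᵥ z t)
      have := hW0 t
      simp only [hc]
      linarith
    rw [tendsto_zero_iff_norm_tendsto_zero]
    simpa using h1.sqrt
  have hC0 : Tendsto (fun t => CFC.sqrt W *ᵥ z t) atTop (𝓝 0) := by
    have hsq : ∀ y, qform W y = (CFC.sqrt W *ᵥ y) ⬝ᵥ (CFC.sqrt W *ᵥ y) := by
      intro y
      have h1 : (CFC.sqrt W)ᵀ = CFC.sqrt W :=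
        transpose_eq_of_posSemidef (nonneg_iff_posSemidef.1 (CFC.sqrt_nonneg W))
      conv_lhs => rw [qform, ← CFC.sqrt_mul_sqrt_self W hW.nonneg, ← mulVec_mulVec,
        dotProduct_mulVec, ← mulVec_transpose, h1]
    refine tendsto_pi_nhds.2 fun i => ?_
    have h1 : Tendsto (fun t => (CFC.sqrt W *ᵥ z t) i ^ 2) atTop (𝓝 0) := by
      refine squeeze_zero (fun t => by positivity) (fun t => ?_) hc0
      have h2 : (CFC.sqrt W *ᵥ z t) i ^ 2 ≤ qform W (z t) := by
        rw [hsq, dotProduct, sq]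
        exact Finset.single_le_sum (f := fun j => (CFC.sqrt W *ᵥ z t) j * (CFC.sqrt W *ᵥ z t) j)
          (fun j _ => mul_self_nonneg _) (Finset.mem_univ i)
      have := hS0 t
      simp only [hc]
      linarith
    simp only [Pi.zero_apply]
    rw [tendsto_zero_iff_norm_tendsto_zero]
    simpa [Real.sqrt_sq_eq_abs] using h1.sqrt
  have hz0 : Tendsto z atTop (𝓝 0) := by
    refine hK.tendsto_zero (f := fun t => (√β • G) *ᵥ L *ᵥ z t - K *ᵥ CFC.sqrt W *ᵥ z t)
      (fun t => ?_) ?_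
    · rw [← hzs, hΦ]
      simp only [add_mulVec, mulVec_mulVec]
      abel
    · have h1 : Continuous fun y : κ → ℝ => (√β • G) *ᵥ y := by fun_prop
      have h2 : Continuous fun y : ι → ℝ => K *ᵥ y := by fun_prop
      simpa using ((h1.tendsto 0).comp hL0).sub ((h2.tendsto 0).comp hC0)
  have hlim : Tendsto (fun T => qform M' x + qform M (z T)) atTop (𝓝 (qform M' x + 0)) := by
    refine tendsto_const_nhds.add ?_
    have h0 : qform M (0 : ι → ℝ) = 0 := by simp [qform]
    have := ((continuous_qform M).tendsto 0).comp hz0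
    rwa [h0] at this
  rw [add_zero] at hlim
  refine ge_of_tendsto' hlim fun T => ?_
  have := heq T
  have := hle T
  have := qform_nonneg hM'.1 (z T)
  linarith

/-- Under stabilizability and detectability value iteration converges to every positive
semi-definite solution of the Riccati equation (which is therefore unique). -/
lemma tendsto_qform_valueIter (hβ : 0 < β) (hW : W.PosSemidef) (hS : S.PosDef)
    (hstab : Stabilizable (√β • F) (√β • G)) (hdet : Detectable (√β • F) (CFC.sqrt W))
    {M : Matrix ι ι ℝ} (hM : SolvesRiccati β F G W S M) (x : ι → ℝ) :
    Tendsto (fun k => qform (valueIter β F G W S k) x) atTop (𝓝 (qform M x)) := by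
  obtain ⟨M', hM', hlim⟩ := hstab.exists_tendsto_valueIter hβ hW hS
  rw [(hdet.qform_le_of_solvesRiccati hβ hW hS hM hM' x).antisymm
    (hdet.qform_le_of_solvesRiccati hβ hW hS hM' hM x)]
  exact hlim x

end Riccati

/-! ### Quadratic costs of noisy linear systems -/

section NoisyRun

variable {ι κ : Type*} [Fintype ι] [Fintype κ] {Ω : Type*} [MeasurableSpace Ω] {μ : Measure Ω}
  {F : Matrix ι ι ℝ} {G : Matrix ι κ ℝ}

/-- `X` is a square-integrable random trajectory of the system `X⁺ = F X + G U + ξ`, along which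
the noise `ξ t` is uncorrelated with the noiseless successor `F X + G U` of the state at time `t`.
Square-integrability is asked coordinatewise. -/
structure IsNoisyRun (μ : Measure Ω) (F : Matrix ι ι ℝ) (G : Matrix ι κ ℝ)
    (X : ℕ → Ω → ι → ℝ) (U : ℕ → Ω → κ → ℝ) (ξ : ℕ → Ω → ι → ℝ) : Prop where
  dynamics : ∀ t ω, X (t + 1) ω = (F *ᵥ X t ω + G *ᵥ U t ω) + ξ t ω
  memLp_state : ∀ t i, MemLp (fun ω => X t ω i) 2 μ
  memLp_action : ∀ t i, MemLp (fun ω => U t ω i) 2 μ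
  memLp_noise : ∀ t i, MemLp (fun ω => ξ t ω i) 2 μ
  uncorrelated : ∀ t i j, ∫ ω, (F *ᵥ X t ω + G *ᵥ U t ω) i * ξ t ω j ∂μ = 0

lemma memLp_mulVec {ι κ : Type*} [Fintype κ] (K : Matrix ι κ ℝ) {V : Ω → κ → ℝ} (hV : ∀ i, MemLp (fun ω => V ω i) 2 μ)
    (i : ι) : MemLp (fun ω => (K *ᵥ V ω) i) 2 μ := by
  simp only [mulVec, dotProduct]
  exact memLp_finsetSum _ fun j _ => (hV j).const_mul _

lemma integrable_qform (M : Matrix ι ι ℝ) {V : Ω → ι → ℝ}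
    (hV : ∀ i, MemLp (fun ω => V ω i) 2 μ) : Integrable (fun ω => qform M (V ω)) μ := by
  simp only [qform_eq_sum]
  exact integrable_finsetSum _ fun i _ => integrable_finsetSum _ fun j _ =>
    ((hV i).integrable_mul (hV j)).const_mul _

lemma integral_qform_add (M : Matrix ι ι ℝ) {V Z : Ω → ι → ℝ}
    (hV : ∀ i, MemLp (fun ω => V ω i) 2 μ) (hZ : ∀ i, MemLp (fun ω => Z ω i) 2 μ)
    (h : ∀ i j, ∫ ω, V ω i * Z ω j ∂μ = 0) :
    ∫ ω, qform M (V ω + Z ω) ∂μ = ∫ ω, qform M (V ω) ∂μ + ∫ ω, qform M (Z ω) ∂μ := by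
  have hVZ : ∀ i j, Integrable (fun ω => V ω i * Z ω j) μ := fun i j =>
    (hV i).integrable_mul (hZ j)
  have key : ∀ ω, qform M (V ω + Z ω) = qform M (V ω) + qform M (Z ω)
      + ∑ i, ∑ j, M i j * (V ω i * Z ω j + V ω j * Z ω i) := by
    intro ω
    simp only [qform_eq_sum, ← Finset.sum_add_distrib, Pi.add_apply]
    exact Finset.sum_congr rfl fun i _ => Finset.sum_congr rfl fun j _ => by ring
  have hcross : ∀ i j, Integrable (fun ω => M i j * (V ω i * Z ω j + V ω j * Z ω i)) μ :=
    fun i j => ((hVZ i j).add (hVZ j i)).const_mul _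
  have hzero : ∫ ω, ∑ i, ∑ j, M i j * (V ω i * Z ω j + V ω j * Z ω i) ∂μ = 0 := by
    rw [integral_finsetSum _ fun i _ => integrable_finsetSum _ fun j _ => hcross i j]
    refine Finset.sum_eq_zero fun i _ => ?_
    rw [integral_finsetSum _ fun j _ => hcross i j]
    refine Finset.sum_eq_zero fun j _ => ?_
    rw [integral_const_mul, integral_add (hVZ i j) (hVZ j i), h, h]
    simp
  have h1 := integrable_qform M hV
  have h2 := integrable_qform M hZ
  have h3 := integral_add (f := fun ω => qform M (V ω) + qform M (Z ω)) (h1.add h2)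
    (integrable_finsetSum Finset.univ fun i _ => integrable_finsetSum Finset.univ fun j _ =>
      hcross i j)
  rw [integral_congr_ae (ae_of_all _ key), h3, hzero, add_zero]
  exact integral_add h1 h2

namespace IsNoisyRun

variable {X : ℕ → Ω → ι → ℝ} {U : ℕ → Ω → κ → ℝ} {ξ : ℕ → Ω → ι → ℝ}

lemma memLp_successor (h : IsNoisyRun μ F G X U ξ) (t : ℕ) (i : ι) :
    MemLp (fun ω => (F *ᵥ X t ω + G *ᵥ U t ω) i) 2 μ :=
  (memLp_mulVec F (h.memLp_state t) i).add (memLp_mulVec G (h.memLp_action t) i)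

lemma integral_qform_succ (h : IsNoisyRun μ F G X U ξ) (M : Matrix ι ι ℝ) (t : ℕ) :
    ∫ ω, qform M (X (t + 1) ω) ∂μ =
      ∫ ω, qform M (F *ᵥ X t ω + G *ᵥ U t ω) ∂μ + ∫ ω, qform M (ξ t ω) ∂μ := by
  simp only [h.dynamics]
  exact integral_qform_add M (h.memLp_successor t) (h.memLp_noise t) (h.uncorrelated t)

variable [DecidableEq κ] {β : ℝ} {W : Matrix ι ι ℝ} {S : Matrix κ κ ℝ}

/-- Dynamic programming: the expected cost of `T` stages is at least the `T`-stage value of the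
state plus, for each noise vector, its value over the stages that remain after it. -/
lemma le_sum_integral_cost (h : IsNoisyRun μ F G X U ξ) (hβ : 0 < β) (hW : W.PosSemidef)
    (hS : S.PosDef) (T s : ℕ) :
    ∫ ω, qform (valueIter β F G W S T) (X s ω) ∂μ
      + ∑ t ∈ Finset.range T, β ^ (t + 1) *
          ∫ ω, qform (valueIter β F G W S (T - 1 - t)) (ξ (s + t) ω) ∂μ ≤
      ∑ t ∈ Finset.range T,
        β ^ t * ∫ ω, (qform W (X (s + t) ω) + qform S (U (s + t) ω)) ∂μ := by
  induction T generalizing s with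
  | zero => simp [valueIter]
  | succ T ih =>
    have hc : Integrable (fun ω => qform W (X s ω) + qform S (U s ω)) μ :=
      (integrable_qform W (h.memLp_state s)).add (integrable_qform S (h.memLp_action s))
    have hY := (integrable_qform (valueIter β F G W S T) (h.memLp_successor s)).const_mul β
    have h1 : ∫ ω, qform (valueIter β F G W S (T + 1)) (X s ω) ∂μ ≤
        ∫ ω, (qform W (X s ω) + qform S (U s ω)) ∂μ
          + β * ∫ ω, qform (valueIter β F G W S T) (F *ᵥ X s ω + G *ᵥ U s ω) ∂μ := by
      rw [← integral_const_mul, ← integral_add hc hY]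
      refine integral_mono (integrable_qform _ (h.memLp_state s)) (hc.add hY) fun ω => ?_
      rw [valueIter_succ]
      exact qform_riccatiOp_le hβ hS (valueIter_posSemidef hβ hW hS T) _ _
    have h2 := h.integral_qform_succ (valueIter β F G W S T) s
    have h3 := mul_le_mul_of_nonneg_left (ih (s + 1)) hβ.le
    rw [mul_add, Finset.mul_sum, Finset.mul_sum, h2] at h3
    rw [Finset.sum_range_succ', Finset.sum_range_succ']
    have e1 : ∀ t, s + 1 + t = s + (t + 1) := fun t => by ring
    have e2 : ∀ t, T + 1 - 1 - (t + 1) = T - 1 - t := fun t => by omega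
    have e3 : ∀ (t : ℕ) (a : ℝ), β * (β ^ t * a) = β ^ (t + 1) * a := fun t a => by ring
    simp only [e1, e3] at h3
    simp only [e2]
    simp only [add_zero, zero_add, pow_zero, pow_one, one_mul, Nat.add_sub_cancel, Nat.sub_zero]
    linarith

/-- The gain feedback of a solution of the Riccati equation: its costs telescope. -/
lemma sum_integral_cost_le_of_gain (h : IsNoisyRun μ F G X U ξ) (hβ : 0 < β) (hS : S.PosDef)
    {M : Matrix ι ι ℝ} (hM : SolvesRiccati β F G W S M)
    (hU : ∀ t ω, U t ω = riccatiGain β F G S M *ᵥ X t ω) (T : ℕ) :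
    ∑ t ∈ Finset.range T, β ^ t * ∫ ω, (qform W (X t ω) + qform S (U t ω)) ∂μ ≤
      ∫ ω, qform M (X 0 ω) ∂μ
        + ∑ t ∈ Finset.range T, β ^ (t + 1) * ∫ ω, qform M (ξ t ω) ∂μ := by
  have key : ∑ t ∈ Finset.range T, β ^ t * ∫ ω, (qform W (X t ω) + qform S (U t ω)) ∂μ
      + β ^ T * ∫ ω, qform M (X T ω) ∂μ = ∫ ω, qform M (X 0 ω) ∂μ
        + ∑ t ∈ Finset.range T, β ^ (t + 1) * ∫ ω, qform M (ξ t ω) ∂μ := by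
    induction T with
    | zero => simp
    | succ T ih =>
      have hc : Integrable (fun ω => qform W (X T ω) + qform S (U T ω)) μ :=
        (integrable_qform W (h.memLp_state T)).add (integrable_qform S (h.memLp_action T))
      have h1 : ∫ ω, qform M (X T ω) ∂μ = ∫ ω, (qform W (X T ω) + qform S (U T ω)) ∂μ
          + β * ∫ ω, qform M (F *ᵥ X T ω + G *ᵥ U T ω) ∂μ := by
        rw [← integral_const_mul,
          ← integral_add hc ((integrable_qform M (h.memLp_successor T)).const_mul β)]
        congr 1 with ω
        rw [hU, ← qform_riccatiOp_eq hβ hS hM.1,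
          ← (show M = riccatiOp β F G W S M from hM.2)]
      rw [Finset.sum_range_succ, Finset.sum_range_succ, ← add_assoc, ← ih,
        h.integral_qform_succ M T, h1]
      ring
  have : 0 ≤ ∫ ω, qform M (X T ω) ∂μ := integral_nonneg fun ω => qform_nonneg hM.1 _
  have := mul_nonneg (pow_nonneg hβ.le T) this
  linarith

variable [DecidableEq ι]

/-- The comparison of the gain feedback with an arbitrary run under the same initial state and
noise. The cost of `T` stages of the former is at most the limit, as the horizon `N` grows, of a
lower bound on the cost of `N` stages of the latter: only the noise of the first `T` stages is kept
in the dynamic programming bound, and its value over the remaining stages increases to the value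
given by the Riccati solution. No bound on the growth of the noise or of the state is involved. -/
lemma exists_tendsto_le_sum_integral_cost {X' : ℕ → Ω → ι → ℝ} {U' : ℕ → Ω → κ → ℝ}
    (h : IsNoisyRun μ F G X U ξ) (h' : IsNoisyRun μ F G X' U' ξ) (hX : X' 0 = X 0)
    (hβ : 0 < β) (hW : W.PosSemidef) (hS : S.PosDef)
    (hstab : Stabilizable (√β • F) (√β • G)) (hdet : Detectable (√β • F) (CFC.sqrt W))
    {M : Matrix ι ι ℝ} (hM : SolvesRiccati β F G W S M)
    (hU : ∀ t ω, U t ω = riccatiGain β F G S M *ᵥ X t ω) (T : ℕ) :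
    ∃ (a : ℕ → ℝ) (l : ℝ), Tendsto a atTop (𝓝 l) ∧
      ∑ t ∈ Finset.range T, β ^ t * ∫ ω, (qform W (X t ω) + qform S (U t ω)) ∂μ ≤ l ∧
      ∀ N, T ≤ N → a N ≤
        ∑ t ∈ Finset.range N, β ^ t * ∫ ω, (qform W (X' t ω) + qform S (U' t ω)) ∂μ := by
  have hlim : ∀ V : Ω → ι → ℝ, (∀ i, MemLp (fun ω => V ω i) 2 μ) →
      Tendsto (fun k => ∫ ω, qform (valueIter β F G W S k) (V ω) ∂μ) atTop
        (𝓝 (∫ ω, qform M (V ω) ∂μ)) := by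
    intro V hV
    refine tendsto_integral_of_dominated_convergence (fun ω => qform M (V ω))
      (fun k => (integrable_qform _ hV).aestronglyMeasurable) (integrable_qform _ hV)
      (fun k => ae_of_all _ fun ω => ?_)
      (ae_of_all _ fun ω => tendsto_qform_valueIter hβ hW hS hstab hdet hM (V ω))
    rw [Real.norm_of_nonneg (qform_nonneg (valueIter_posSemidef hβ hW hS k) _)]
    exact qform_valueIter_le hβ hW hS hM k _
  refine ⟨fun N => ∫ ω, qform (valueIter β F G W S N) (X 0 ω) ∂μ
      + ∑ t ∈ Finset.range T, β ^ (t + 1) *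
          ∫ ω, qform (valueIter β F G W S (N - 1 - t)) (ξ t ω) ∂μ, _,
    (hlim _ (h.memLp_state 0)).add (tendsto_finsetSum _ fun t _ => Tendsto.const_mul _
      ((hlim _ (h.memLp_noise t)).comp (?_ : Tendsto (fun N => N - 1 - t) atTop atTop))),
    h.sum_integral_cost_le_of_gain hβ hS hM hU T, fun N hN => ?_⟩
  · simp_rw [Nat.sub_sub]
    exact tendsto_sub_atTop_nat _
  · have := h'.le_sum_integral_cost hβ hW hS N 0
    simp only [zero_add, hX] at this
    refine le_trans (add_le_add le_rfl ?_) this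
    refine Finset.sum_le_sum_of_subset_of_nonneg (Finset.range_mono hN) fun t _ _ => ?_
    exact mul_nonneg (by positivity)
      (integral_nonneg fun ω => qform_nonneg (valueIter_posSemidef hβ hW hS _) _)

end IsNoisyRun

end NoisyRun

/-! ### Decoupling the network into deviations and the leader-mean-field pair -/

section Decoupling

variable {n d dx du : ℕ}

/-- The deviation of follower `i` from the mean-field, as a linear map of the joint vector. -/
noncomputable def deviation (n d : ℕ) (i : Fin n) : Joint n d →ₗ[ℝ] (Fin d → ℝ) where
  toFun x := x i.succ - meanField x
  map_add' x y := by
    simp only [meanField, Pi.add_apply, Finset.sum_add_distrib, smul_add]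
    abel
  map_smul' c x := by
    simp only [meanField, Pi.smul_apply, ← Finset.smul_sum, smul_sub, RingHom.id_apply,
      smul_comm c]

/-- The leader's entry stacked on the mean-field, as a linear map of the joint vector. -/
noncomputable def leaderMean (n d : ℕ) : Joint n d →ₗ[ℝ] (Fin d ⊕ Fin d → ℝ) where
  toFun x := Sum.elim (x 0) (meanField x)
  map_add' x y := by
    ext (k | k) <;> simp [meanField, Finset.sum_add_distrib]
  map_smul' c x := by
    ext (k | k) <;> simp [meanField, ← Finset.mul_sum, mul_left_comm]

lemma deviation_apply (i : Fin n) (x : Joint n d) :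
    deviation n d i x = x i.succ - meanField x := rfl

lemma leaderMean_apply (x : Joint n d) : leaderMean n d x = Sum.elim (x 0) (meanField x) := rfl

lemma meanField_cons_const_add (hn : 0 < n) (a b : Fin d → ℝ) (f : Fin n → Fin d → ℝ) :
    meanField (Fin.cons a fun i => f i + b : Joint n d) = (n : ℝ)⁻¹ • ∑ i, f i + b := by
  have : (n : ℝ) ≠ 0 := by positivity
  simp only [meanField, Fin.cons_succ, Finset.sum_add_distrib, Finset.sum_const,
    Finset.card_univ, Fintype.card_fin, smul_add, ← Nat.cast_smul_eq_nsmul ℝ, smul_smul,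
    inv_mul_cancel₀ this, one_smul]

lemma sum_deviation (hn : 0 < n) (x : Joint n d) : ∑ i, deviation n d i x = 0 := by
  have : (n : ℝ) ≠ 0 := by positivity
  simp only [deviation_apply, meanField, Finset.sum_sub_distrib, Finset.sum_const,
    Finset.card_univ, Fintype.card_fin, ← Nat.cast_smul_eq_nsmul ℝ, smul_smul,
    mul_inv_cancel₀ this, one_smul, sub_self]

lemma meanField_mulVec {e : ℕ} (K : Matrix (Fin e) (Fin d) ℝ) (x : Joint n d) :
    (n : ℝ)⁻¹ • ∑ i : Fin n, K *ᵥ x i.succ = K *ᵥ meanField x := by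
  rw [meanField, mulVec_smul, mulVec_sum]

variable (m : Model dx du)

lemma meanField_step (hn : 0 < n) (x : Joint n dx) (u : Joint n du) (w : Joint n dx) :
    meanField (m.step x u w) = m.A *ᵥ meanField x + m.B *ᵥ meanField u + m.D *ᵥ meanField x
      + m.E *ᵥ x 0 + meanField w := by
  have h := meanField_cons_const_add hn
    (m.A0 *ᵥ x 0 + m.B0 *ᵥ u 0 + m.D0 *ᵥ meanField x + w 0)
    (m.D *ᵥ meanField x + m.E *ᵥ x 0)
    (fun i : Fin n => m.A *ᵥ x i.succ + m.B *ᵥ u i.succ + w i.succ)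
  rw [Finset.sum_add_distrib, Finset.sum_add_distrib, smul_add, smul_add, meanField_mulVec,
    meanField_mulVec] at h
  rw [Model.step, show (fun i : Fin n => m.A *ᵥ x i.succ + m.B *ᵥ u i.succ + m.D *ᵥ meanField x
      + m.E *ᵥ x 0 + w i.succ) = fun i : Fin n => m.A *ᵥ x i.succ + m.B *ᵥ u i.succ + w i.succ
        + (m.D *ᵥ meanField x + m.E *ᵥ x 0) by ext1 i; abel, h, ← meanField]
  abel

lemma deviation_step (hn : 0 < n) (i : Fin n) (x : Joint n dx) (u : Joint n du)
    (w : Joint n dx) :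
    deviation n dx i (m.step x u w) =
      m.A *ᵥ deviation n dx i x + m.B *ᵥ deviation n du i u + deviation n dx i w := by
  rw [deviation_apply, meanField_step m hn]
  simp only [Model.step, Fin.cons_succ, deviation_apply, mulVec_sub]
  abel

lemma leaderMean_step (hn : 0 < n) (x : Joint n dx) (u : Joint n du) (w : Joint n dx) :
    leaderMean n dx (m.step x u w) =
      m.Abar *ᵥ leaderMean n dx x + m.Bbar *ᵥ leaderMean n du u + leaderMean n dx w := by
  rw [leaderMean_apply, meanField_step m hn]
  simp only [Model.step, Fin.cons_zero, leaderMean_apply, Model.Abar, Model.Bbar,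
    fromBlocks_mulVec, Sum.elim_comp_inl, Sum.elim_comp_inr, zero_mulVec, add_zero, zero_add,
    add_mulVec]
  ext (k | k) <;> simp <;> ring

section LinearStrategy

variable (Lb : Matrix (Fin du) (Fin dx) ℝ) (Lbar : Matrix (Fin du ⊕ Fin du) (Fin dx ⊕ Fin dx) ℝ)

lemma meanField_action_linearStrategy (hn : 0 < n) (t : ℕ) (x : Joint n dx) :
    meanField ((linearStrategy n Lb Lbar).action t x) =
      Lbar.toBlocks₂₁ *ᵥ x 0 + Lbar.toBlocks₂₂ *ᵥ meanField x := by
  have h := meanField_cons_const_add hn (Lbar.toBlocks₁₁ *ᵥ x 0 + Lbar.toBlocks₁₂ *ᵥ meanField x)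
    (Lbar.toBlocks₂₁ *ᵥ x 0 + (Lbar.toBlocks₂₂ - Lb) *ᵥ meanField x)
    (fun i : Fin n => Lb *ᵥ x i.succ)
  simp only [← add_assoc] at h
  refine Eq.trans h ?_
  rw [meanField_mulVec, sub_mulVec]
  abel

lemma deviation_action_linearStrategy (hn : 0 < n) (t : ℕ) (i : Fin n) (x : Joint n dx) :
    deviation n du i ((linearStrategy n Lb Lbar).action t x) = Lb *ᵥ deviation n dx i x := by
  rw [deviation_apply, meanField_action_linearStrategy Lb Lbar hn]
  simp only [Strategy.action, linearStrategy, Fin.cons_succ, deviation_apply, mulVec_sub,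
    sub_mulVec]
  abel

lemma leaderMean_action_linearStrategy (hn : 0 < n) (t : ℕ) (x : Joint n dx) :
    leaderMean n du ((linearStrategy n Lb Lbar).action t x) = Lbar *ᵥ leaderMean n dx x := by
  rw [leaderMean_apply, meanField_action_linearStrategy Lb Lbar hn]
  conv_rhs => rw [← fromBlocks_toBlocks Lbar]
  simp [Strategy.action, linearStrategy, leaderMean_apply, fromBlocks_mulVec]

end LinearStrategy

lemma sum_quad_add {ι : Type*} [Fintype ι] (M : Matrix (Fin d) (Fin d) ℝ) {f : ι → Fin d → ℝ}
    (hf : ∑ i, f i = 0) (c : Fin d → ℝ) :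
    ∑ i, quad M (f i + c) = ∑ i, quad M (f i) + Fintype.card ι * quad M c := by
  have h1 : ∑ i, f i ⬝ᵥ M *ᵥ c = 0 := by rw [← sum_dotProduct, hf, zero_dotProduct]
  have h2 : ∑ i, c ⬝ᵥ M *ᵥ f i = 0 := by rw [← dotProduct_sum, ← mulVec_sum, hf]; simp
  simp only [quad, mulVec_add, dotProduct_add, add_dotProduct, Finset.sum_add_distrib, h1, h2]
  simp

lemma quad_eq_qform (M : Matrix (Fin d) (Fin d) ℝ) : quad M = qform M := rfl

lemma qform_fromBlocks_elim {ι : Type*} [Fintype ι] (K L M N : Matrix ι ι ℝ) (a b : ι → ℝ) :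
    qform (fromBlocks K L M N) (Sum.elim a b) =
      a ⬝ᵥ K *ᵥ a + a ⬝ᵥ L *ᵥ b + b ⬝ᵥ M *ᵥ a + b ⬝ᵥ N *ᵥ b := by
  simp [qform, fromBlocks_mulVec, dotProduct_add]
  ring

/-- The stage cost decouples: the mean-field and the deviations are orthogonal because the
deviations sum to zero. -/
lemma stageCost_eq (hn : 0 < n) (x : Joint n dx) (u : Joint n du) :
    m.stageCost x u =
      (n : ℝ)⁻¹ * ∑ i, (qform (m.Q + m.P + m.H) (deviation n dx i x)
        + qform m.R (deviation n du i u))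
      + (qform m.Qbar (leaderMean n dx x) + qform m.Rbar (leaderMean n du u)) := by
  have hn' : (n : ℝ) ≠ 0 := by positivity
  have hx : ∀ i : Fin n, x i.succ = deviation n dx i x + meanField x := fun i => by
    simp [deviation_apply]
  have hu : ∀ i : Fin n, u i.succ = deviation n du i u + meanField u := fun i => by
    simp [deviation_apply]
  have hxd := sum_deviation hn x
  have hnd : ∑ i, -deviation n dx i x = 0 := by simp [hxd]
  have h1 : ∑ i : Fin n, quad m.Q (x i.succ) =
      ∑ i, quad m.Q (deviation n dx i x) + n * quad m.Q (meanField x) := by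
    simpa only [← hx, Fintype.card_fin] using sum_quad_add m.Q hxd (meanField x)
  have h2 : ∑ i : Fin n, quad m.P (x i.succ - x 0) =
      ∑ i, quad m.P (deviation n dx i x) + n * quad m.P (meanField x - x 0) := by
    simpa only [← add_sub_assoc, ← hx, Fintype.card_fin] using
      sum_quad_add m.P hxd (meanField x - x 0)
  have h3 : ∑ i : Fin n, quad m.R (u i.succ) =
      ∑ i, quad m.R (deviation n du i u) + n * quad m.R (meanField u) := by
    simpa only [← hu, Fintype.card_fin] using
      sum_quad_add m.R (sum_deviation hn u) (meanField u)
  have h4 : ∑ i : Fin n, ∑ j : Fin n, quad m.H (x i.succ - x j.succ) =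
      2 * n * ∑ i, quad m.H (deviation n dx i x) := by
    have h5 : ∀ i : Fin n, ∑ j : Fin n, quad m.H (x i.succ - x j.succ) =
        ∑ j, quad m.H (deviation n dx j x) + n * quad m.H (deviation n dx i x) := by
      intro i
      have := sum_quad_add m.H hnd (deviation n dx i x)
      simp only [Fintype.card_fin] at this
      have e : ∀ j, quad m.H (-deviation n dx j x) = quad m.H (deviation n dx j x) := fun j => by
        simp [quad, mulVec_neg]
      simp only [e] at this
      rw [← this]
      refine Finset.sum_congr rfl fun j _ => ?_
      rw [hx i, hx j]
      congr 1
      abel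
    simp only [h5, Finset.sum_add_distrib, ← Finset.mul_sum, Finset.sum_const, Finset.card_univ,
      Fintype.card_fin, nsmul_eq_mul]
    ring
  have h6 : qform m.Qbar (leaderMean n dx x) = quad m.Q0 (x 0) + quad m.Q (meanField x)
      + quad m.P (meanField x - x 0) := by
    rw [leaderMean_apply, Model.Qbar, qform_fromBlocks_elim]
    simp only [quad, add_mulVec, neg_mulVec, mulVec_sub, dotProduct_add, dotProduct_neg,
      dotProduct_sub, sub_dotProduct]
    ring
  have h7 : qform m.Rbar (leaderMean n du u) = quad m.R0 (u 0) + quad m.R (meanField u) := by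
    rw [leaderMean_apply, Model.Rbar, qform_fromBlocks_elim]
    simp [quad]
  simp only [Model.stageCost, Finset.sum_add_distrib, h1, h2, h3, h4, h6, h7]
  simp only [qform_add_matrix, quad_eq_qform, Finset.sum_add_distrib]
  field_simp
  ring

lemma Rbar_posDef (hR0 : m.R0.PosDef) (hR : m.R.PosDef) : m.Rbar.PosDef := by
  have e0 := transpose_eq_of_posSemidef hR0.posSemidef
  have e1 := transpose_eq_of_posSemidef hR.posSemidef
  refine .of_dotProduct_mulVec_pos ?_ fun v hv => ?_
  · simp [IsHermitian, Model.Rbar, fromBlocks_transpose, e0, e1]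
  · have h := qform_fromBlocks_elim m.R0 0 0 m.R (v ∘ Sum.inl) (v ∘ Sum.inr)
    rw [Sum.elim_comp_inl_inr] at h
    simp only [zero_mulVec, dotProduct_zero, add_zero] at h
    change 0 < qform (fromBlocks m.R0 0 0 m.R) v
    rw [h]
    have p0 := qform_nonneg hR0.posSemidef (v ∘ Sum.inl)
    have p1 := qform_nonneg hR.posSemidef (v ∘ Sum.inr)
    unfold qform at p0 p1
    by_cases hl : v ∘ Sum.inl = 0
    · have hr : v ∘ Sum.inr ≠ 0 := by
        intro hr
        refine hv ?_
        ext (k | k)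
        · exact congrFun hl k
        · exact congrFun hr k
      have := hR.dotProduct_mulVec_pos hr
      simp only [star_trivial] at this
      linarith
    · have := hR0.dotProduct_mulVec_pos hl
      simp only [star_trivial] at this
      linarith

end Decoupling

/-! ### Trajectories of the network as noisy linear systems -/

section Trajectories

variable {n dx du : ℕ} {Ω : Type*}

/-- The random state of the network at time `t` under the strategy `g`. -/
noncomputable def randomState (m : Model dx du) (g : Strategy n dx du) (x₁ : Ω → Joint n dx)
    (w : ℕ → Ω → Joint n dx) (t : ℕ) (ω : Ω) : Joint n dx :=
  m.trajectory g (x₁ ω) (fun s => w s ω) t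

/-- The random action of the network at time `t` under the strategy `g`. -/
noncomputable def randomAction (m : Model dx du) (g : Strategy n dx du) (x₁ : Ω → Joint n dx)
    (w : ℕ → Ω → Joint n dx) (t : ℕ) (ω : Ω) : Joint n du :=
  g.action t (randomState m g x₁ w t ω)

lemma randomState_succ (m : Model dx du) (g : Strategy n dx du) (x₁ : Ω → Joint n dx)
    (w : ℕ → Ω → Joint n dx) (t : ℕ) (ω : Ω) :
    randomState m g x₁ w (t + 1) ω =
      m.step (randomState m g x₁ w t ω) (randomAction m g x₁ w t ω) (w t ω) := rfl

lemma continuous_meanField {d : ℕ} : Continuous (meanField : Joint n d → Fin d → ℝ) := by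
  unfold meanField
  fun_prop

lemma Strategy.measurable_action (g : Strategy n dx du) (t : ℕ) : Measurable (g.action t) := by
  have hm : Measurable (meanField : Joint n dx → Fin dx → ℝ) := continuous_meanField.measurable
  refine measurable_pi_iff.2 fun k => ?_
  cases k using Fin.cases with
  | zero =>
    exact (g.measurable_leader t).comp ((measurable_pi_apply 0).prodMk hm)
  | succ i =>
    exact (g.measurable_follower t i).comp
      ((measurable_pi_apply i.succ).prodMk (hm.prodMk (measurable_pi_apply 0)))

lemma continuous_step (m : Model dx du) :
    Continuous fun p : Joint n dx × Joint n du × Joint n dx => m.step p.1 p.2.1 p.2.2 := by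
  refine continuous_pi fun k => ?_
  cases k using Fin.cases with
  | zero =>
    simp only [Model.step, Fin.cons_zero, meanField]
    fun_prop
  | succ i =>
    simp only [Model.step, Fin.cons_succ, meanField]
    fun_prop

lemma measurable_closedLoop (m : Model dx du) (g : Strategy n dx du) (t : ℕ) {α : Type*}
    {_ : MeasurableSpace α} {X V : α → Joint n dx} (hX : Measurable X) (hV : Measurable V) :
    Measurable fun a => m.step (X a) (g.action t (X a)) (V a) := by
  have h : Measurable fun p : Joint n dx × Joint n du × Joint n dx => m.step p.1 p.2.1 p.2.2 :=
    (continuous_step m).measurable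
  have hU : Measurable fun a => g.action t (X a) := (g.measurable_action t).comp hX
  exact Measurable.comp (g := fun p : Joint n dx × Joint n du × Joint n dx =>
    m.step p.1 p.2.1 p.2.2) (f := fun a => (X a, g.action t (X a), V a)) h
    (hX.prodMk (hU.prodMk hV))

/-- The state at time `t` depends only on the primitive random vectors with index at most `t`. -/
lemma measurable_randomState_past (m : Model dx du) (g : Strategy n dx du) (x₁ : Ω → Joint n dx)
    (w : ℕ → Ω → Joint n dx) (t : ℕ) :
    Measurable[⨆ i ∈ Set.Iic t, MeasurableSpace.comap (primitives x₁ w i) inferInstance]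
      (randomState m g x₁ w t) := by
  induction t with
  | zero =>
    exact Measurable.mono (comap_measurable (primitives x₁ w 0))
      (le_biSup (fun i => MeasurableSpace.comap (primitives x₁ w i) inferInstance)
        (Set.mem_Iic.2 le_rfl)) le_rfl
  | succ t ih =>
    have hX := Measurable.mono ih (biSup_mono fun i hi =>
      Set.mem_Iic.2 ((Set.mem_Iic.1 hi).trans t.le_succ)) le_rfl
    have hw := Measurable.mono (comap_measurable (primitives x₁ w (t + 1)))
      (le_biSup (fun i => MeasurableSpace.comap (primitives x₁ w i) inferInstance)
        (Set.mem_Iic.2 (le_refl (t + 1)))) le_rfl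
    exact measurable_closedLoop m g t hX hw

variable [MeasurableSpace Ω]

/-- The standing assumptions on the primitive random vectors: square-integrability, centred noise,
independence in time. -/
structure AdmissiblePrimitives (μ : Measure Ω) (x₁ : Ω → Joint n dx) (w : ℕ → Ω → Joint n dx) :
    Prop where
  measurable_init : Measurable x₁
  measurable_noise : ∀ t, Measurable (w t)
  memLp_init : MemLp x₁ 2 μ
  memLp_noise : ∀ t, MemLp (w t) 2 μ
  integral_noise : ∀ t, ∫ ω, w t ω ∂μ = 0
  indep : iIndepFun (primitives x₁ w) μ

namespace AdmissiblePrimitives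

variable {μ : Measure Ω} {x₁ : Ω → Joint n dx} {w : ℕ → Ω → Joint n dx}

lemma measurable_primitives (h : AdmissiblePrimitives μ x₁ w) :
    ∀ i, Measurable (primitives x₁ w i)
  | 0 => h.measurable_init
  | t + 1 => h.measurable_noise t

lemma measurable_randomState (h : AdmissiblePrimitives μ x₁ w) (m : Model dx du)
    (g : Strategy n dx du) (t : ℕ) : Measurable (randomState m g x₁ w t) :=
  (measurable_randomState_past m g x₁ w t).mono
    (iSup₂_le fun i _ => (h.measurable_primitives i).comap_le) le_rfl

lemma measurable_randomAction (h : AdmissiblePrimitives μ x₁ w) (m : Model dx du)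
    (g : Strategy n dx du) (t : ℕ) : Measurable (randomAction m g x₁ w t) :=
  (g.measurable_action t).comp (h.measurable_randomState m g t)

lemma indepFun_randomState_noise (h : AdmissiblePrimitives μ x₁ w) (m : Model dx du)
    (g : Strategy n dx du) (t : ℕ) : IndepFun (randomState m g x₁ w t) (w t) μ := by
  have h1 := indep_iSup_of_disjoint (fun i => (h.measurable_primitives i).comap_le)
    h.indep (S := Set.Iic t) (T := {t + 1}) (by simp)
  rw [IndepFun_iff_Indep]
  refine indep_of_indep_of_le_right (indep_of_indep_of_le_left h1
    (measurable_randomState_past m g x₁ w t).comap_le) ?_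
  exact le_biSup (fun i => MeasurableSpace.comap (primitives x₁ w i) inferInstance)
    (Set.mem_singleton (t + 1))

variable {ι κ : Type*} [Fintype ι] [Fintype κ] {F : Matrix ι ι ℝ} {G : Matrix ι κ ℝ}

lemma memLp_linear {ι : Type*} {V : Ω → Joint n dx} (hV : MemLp V 2 μ)
    (p : Joint n dx →ₗ[ℝ] (ι → ℝ)) (i : ι) : MemLp (fun ω => p (V ω) i) 2 μ :=
  (LinearMap.toContinuousLinearMap ((LinearMap.proj i : (ι → ℝ) →ₗ[ℝ] ℝ) ∘ₗ p)).comp_memLp' hV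

lemma integral_linear_eq_zero {ι : Type*} [IsFiniteMeasure μ] {V : Ω → Joint n dx} (hV : MemLp V 2 μ)
    (hV0 : ∫ ω, V ω ∂μ = 0) (p : Joint n dx →ₗ[ℝ] (ι → ℝ)) (i : ι) :
    ∫ ω, p (V ω) i ∂μ = 0 := by
  have := (LinearMap.toContinuousLinearMap ((LinearMap.proj i : (ι → ℝ) →ₗ[ℝ] ℝ) ∘ₗ p)).integral_comp_comm
    (hV.integrable (by norm_num))
  rw [hV0, map_zero] at this
  exact this

/-- If linear images `p`, `q` of the joint state and action follow a linear system of their own and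
the image of the action is square-integrable, then they form a noisy run of that system. -/
lemma isNoisyRun [IsFiniteMeasure μ] (h : AdmissiblePrimitives μ x₁ w) (m : Model dx du)
    (g : Strategy n dx du) (p : Joint n dx →ₗ[ℝ] (ι → ℝ)) (q : Joint n du →ₗ[ℝ] (κ → ℝ))
    (hpq : ∀ x u v, p (m.step x u v) = F *ᵥ p x + G *ᵥ q u + p v)
    (hq : ∀ t i, MemLp (fun ω => q (randomAction m g x₁ w t ω) i) 2 μ) :
    IsNoisyRun μ F G (fun t ω => p (randomState m g x₁ w t ω))
      (fun t ω => q (randomAction m g x₁ w t ω)) (fun t ω => p (w t ω)) where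
  dynamics t ω := hpq _ _ _
  memLp_state t := by
    induction t with
    | zero => exact memLp_linear h.memLp_init p
    | succ t ih =>
      intro i
      simp only [randomState_succ, hpq]
      exact ((memLp_mulVec F ih i).add (memLp_mulVec G (hq t) i)).add
        (memLp_linear (h.memLp_noise t) p i)
  memLp_action := hq
  memLp_noise t := memLp_linear (h.memLp_noise t) p
  uncorrelated t i j := by
    have hp : Measurable p := p.continuous_of_finiteDimensional.measurable
    have hqm : Measurable q := q.continuous_of_finiteDimensional.measurable
    have hF : Measurable fun y : ι → ℝ => F *ᵥ y :=
      (by fun_prop : Continuous fun y : ι → ℝ => F *ᵥ y).measurable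
    have hG : Measurable fun y : κ → ℝ => G *ᵥ y :=
      (by fun_prop : Continuous fun y : κ → ℝ => G *ᵥ y).measurable
    have hφ : Measurable fun x : Joint n dx => (F *ᵥ p x + G *ᵥ q (g.action t x)) i :=
      (measurable_pi_apply i).comp
        ((hF.comp hp).add (hG.comp (hqm.comp (g.measurable_action t))))
    have hψ : Measurable fun v : Joint n dx => p v j := (measurable_pi_apply j).comp hp
    have hind := (h.indepFun_randomState_noise m g t).comp hφ hψ
    have := hind.integral_fun_mul_eq_mul_integral
      (hφ.comp (h.measurable_randomState m g t)).aestronglyMeasurable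
      (hψ.comp (h.measurable_noise t)).aestronglyMeasurable
    refine this.trans ?_
    simp only [Function.comp_apply]
    rw [integral_linear_eq_zero (h.memLp_noise t) (h.integral_noise t), mul_zero]

/-- Under a linear feedback square-integrability propagates along the closed loop. -/
lemma memLp_action_of_feedback (h : AdmissiblePrimitives μ x₁ w) (m : Model dx du)
    (g : Strategy n dx du) (p : Joint n dx →ₗ[ℝ] (ι → ℝ)) (q : Joint n du →ₗ[ℝ] (κ → ℝ))
    (hpq : ∀ x u v, p (m.step x u v) = F *ᵥ p x + G *ᵥ q u + p v) (L : Matrix κ ι ℝ)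
    (hL : ∀ t x, q (g.action t x) = L *ᵥ p x) (t : ℕ) (i : κ) :
    MemLp (fun ω => q (randomAction m g x₁ w t ω) i) 2 μ := by
  have hX : ∀ i, MemLp (fun ω => p (randomState m g x₁ w t ω) i) 2 μ := by
    induction t with
    | zero => exact memLp_linear h.memLp_init p
    | succ t ih =>
      intro i
      simp only [randomState_succ, hpq, randomAction, hL]
      exact ((memLp_mulVec F ih i).add (memLp_mulVec G (memLp_mulVec L ih) i)).add
        (memLp_linear (h.memLp_noise t) p i)
  simp only [randomAction, hL]
  exact memLp_mulVec L hX i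

end AdmissiblePrimitives

/-- A random vector on which a positive definite form has an integrable majorant is
square-integrable. -/
lemma memLp_two_of_qform_le {κ : Type*} [Fintype κ] {μ : Measure Ω} {S : Matrix κ κ ℝ}
    (hS : S.PosDef) {V : Ω → κ → ℝ} (hV : Measurable V) {c : Ω → ℝ} (hc : Integrable c μ)
    (hle : ∀ ω, qform S (V ω) ≤ c ω) (i : κ) : MemLp (fun ω => V ω i) 2 μ := by
  obtain ⟨a, ha, hbound⟩ := exists_pos_mul_sq_le_qform hS
  have hm : Measurable fun ω => V ω i := (measurable_pi_apply i).comp hV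
  rw [memLp_two_iff_integrable_sq hm.aestronglyMeasurable]
  refine (hc.const_mul a⁻¹).mono' (hm.pow_const 2).aestronglyMeasurable (ae_of_all _ fun ω => ?_)
  rw [Real.norm_of_nonneg (sq_nonneg _), ← div_eq_inv_mul, le_div_iff₀ ha, mul_comm]
  refine le_trans ?_ ((hbound _).trans (hle ω))
  have h1 := norm_le_pi_norm (V ω) i
  rw [Real.norm_eq_abs] at h1
  rw [← sq_abs]
  gcongr

end Trajectories

/-! ### The infinite-horizon cost -/

section Cost

variable {n dx du : ℕ} {Ω : Type*} [MeasurableSpace Ω] {μ : Measure Ω}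
  {x₁ : Ω → Joint n dx} {w : ℕ → Ω → Joint n dx} {m : Model dx du} {β : ℝ}

/-- The random cost of stage `t`, undiscounted. -/
noncomputable def randomStageCost (m : Model dx du) (g : Strategy n dx du) (x₁ : Ω → Joint n dx)
    (w : ℕ → Ω → Joint n dx) (t : ℕ) (ω : Ω) : ℝ :=
  m.stageCost (randomState m g x₁ w t ω) (randomAction m g x₁ w t ω)

lemma continuous_stageCost (m : Model dx du) :
    Continuous fun p : Joint n dx × Joint n du => m.stageCost p.1 p.2 := by
  simp only [Model.stageCost, quad]
  fun_prop

lemma stageCost_nonneg (hn : 0 < n) (hQ : (m.Q + m.P + m.H).PosSemidef)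
    (hQbar : m.Qbar.PosSemidef) (hR0 : m.R0.PosDef) (hR : m.R.PosDef) (x : Joint n dx)
    (u : Joint n du) : 0 ≤ m.stageCost x u := by
  rw [stageCost_eq m hn]
  exact add_nonneg (mul_nonneg (by positivity) (Finset.sum_nonneg fun i _ =>
    add_nonneg (qform_nonneg hQ _) (qform_nonneg hR.posSemidef _)))
    (add_nonneg (qform_nonneg hQbar _) (qform_nonneg (Rbar_posDef m hR0 hR).posSemidef _))

lemma AdmissiblePrimitives.measurable_randomStageCost (h : AdmissiblePrimitives μ x₁ w)
    (g : Strategy n dx du) (t : ℕ) : Measurable (randomStageCost m g x₁ w t) :=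
  (continuous_stageCost m).measurable.comp
    ((h.measurable_randomState m g t).prodMk (h.measurable_randomAction m g t))

lemma AdmissiblePrimitives.cost_eq_tsum (h : AdmissiblePrimitives μ x₁ w)
    (g : Strategy n dx du) :
    m.cost μ β x₁ w g =
      ∑' t, ∫⁻ ω, ENNReal.ofReal (β ^ t * randomStageCost m g x₁ w t ω) ∂μ :=
  lintegral_tsum fun t =>
    (((h.measurable_randomStageCost g t).const_mul _).ennreal_ofReal).aemeasurable

lemma sum_lintegral_eq_ofReal (hβ : 0 < β) {c : ℕ → Ω → ℝ} (hc : ∀ t, Integrable (c t) μ)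
    (hc0 : ∀ t ω, 0 ≤ c t ω) (T : ℕ) :
    ∑ t ∈ Finset.range T, ∫⁻ ω, ENNReal.ofReal (β ^ t * c t ω) ∂μ =
      ENNReal.ofReal (∑ t ∈ Finset.range T, β ^ t * ∫ ω, c t ω ∂μ) := by
  rw [ENNReal.ofReal_sum_of_nonneg fun t _ =>
    mul_nonneg (by positivity) (integral_nonneg (hc0 t))]
  refine Finset.sum_congr rfl fun t _ => ?_
  rw [← integral_const_mul, ofReal_integral_eq_lintegral_ofReal ((hc t).const_mul _)
    (ae_of_all _ fun ω => mul_nonneg (by positivity) (hc0 t ω))]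

lemma AdmissiblePrimitives.integrable_randomStageCost_of_cost_ne_top
    (h : AdmissiblePrimitives μ x₁ w) (hβ : 0 < β) {g : Strategy n dx du}
    (hc0 : ∀ t ω, 0 ≤ randomStageCost m g x₁ w t ω) (hfin : m.cost μ β x₁ w g ≠ ∞) (t : ℕ) :
    Integrable (randomStageCost m g x₁ w t) μ := by
  rw [h.cost_eq_tsum] at hfin
  have h1 := ENNReal.ne_top_of_tsum_ne_top hfin t
  have hm := (h.measurable_randomStageCost (m := m) g t).const_mul (β ^ t)
  have h2 : Integrable (fun ω => β ^ t * randomStageCost m g x₁ w t ω) μ :=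
    (lintegral_ofReal_ne_top_iff_integrable hm.aestronglyMeasurable
      (ae_of_all _ fun ω => mul_nonneg (by positivity) (hc0 t ω))).1 h1
  have h3 := h2.const_mul (β ^ t)⁻¹
  simpa [← mul_assoc, inv_mul_cancel₀ (pow_pos hβ t).ne'] using h3

/-- If the deviations and the leader-mean-field pair are noisy runs, the stage costs are integrable
and their expectations split accordingly. -/
lemma integral_randomStageCost (hn : 0 < n) {g : Strategy n dx du}
    (hd : ∀ i, IsNoisyRun μ m.A m.B (fun t ω => deviation n dx i (randomState m g x₁ w t ω))
      (fun t ω => deviation n du i (randomAction m g x₁ w t ω))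
      (fun t ω => deviation n dx i (w t ω)))
    (hp : IsNoisyRun μ m.Abar m.Bbar (fun t ω => leaderMean n dx (randomState m g x₁ w t ω))
      (fun t ω => leaderMean n du (randomAction m g x₁ w t ω))
      (fun t ω => leaderMean n dx (w t ω))) (t : ℕ) :
    Integrable (randomStageCost m g x₁ w t) μ ∧
    ∫ ω, randomStageCost m g x₁ w t ω ∂μ =
      (n : ℝ)⁻¹ * ∑ i, ∫ ω,
        (qform (m.Q + m.P + m.H) (deviation n dx i (randomState m g x₁ w t ω))
          + qform m.R (deviation n du i (randomAction m g x₁ w t ω))) ∂μ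
      + ∫ ω, (qform m.Qbar (leaderMean n dx (randomState m g x₁ w t ω))
          + qform m.Rbar (leaderMean n du (randomAction m g x₁ w t ω))) ∂μ := by
  have h1 : ∀ i, Integrable (fun ω =>
      qform (m.Q + m.P + m.H) (deviation n dx i (randomState m g x₁ w t ω))
        + qform m.R (deviation n du i (randomAction m g x₁ w t ω))) μ := fun i =>
    (integrable_qform _ ((hd i).memLp_state t)).add (integrable_qform _ ((hd i).memLp_action t))
  have h2 : Integrable (fun ω => qform m.Qbar (leaderMean n dx (randomState m g x₁ w t ω))
      + qform m.Rbar (leaderMean n du (randomAction m g x₁ w t ω))) μ :=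
    (integrable_qform _ (hp.memLp_state t)).add (integrable_qform _ (hp.memLp_action t))
  have h3 := (integrable_finsetSum Finset.univ fun i _ => h1 i).const_mul (n : ℝ)⁻¹
  have hc : randomStageCost m g x₁ w t = _ := funext fun ω => stageCost_eq m hn _ _
  rw [hc]
  refine ⟨h3.add h2, ?_⟩
  rw [integral_add h3 h2, integral_const_mul, integral_finsetSum _ fun i _ => h1 i]

/-- The gain feedbacks of the two Riccati equations are optimal: the costs of the decoupled systems
are compared one by one, and a strategy of infinite cost needs no comparison. A strategy of finite
cost has square-integrable actions, because the action weights are positive definite. -/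
lemma AdmissiblePrimitives.isOptimal_linearStrategy [IsFiniteMeasure μ]
    (h : AdmissiblePrimitives μ x₁ w) (hn : 0 < n) (hβ : 0 < β)
    (hQ : (m.Q + m.P + m.H).PosSemidef) (hQbar : m.Qbar.PosSemidef)
    (hR0 : m.R0.PosDef) (hR : m.R.PosDef)
    (hstab : Stabilizable (√β • m.A) (√β • m.B))
    (hstabbar : Stabilizable (√β • m.Abar) (√β • m.Bbar))
    (hdet : Detectable (√β • m.A) (CFC.sqrt (m.Q + m.P + m.H)))
    (hdetbar : Detectable (√β • m.Abar) (CFC.sqrt m.Qbar))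
    {Mb : Matrix (Fin dx) (Fin dx) ℝ} {Mbar : Matrix (Fin dx ⊕ Fin dx) (Fin dx ⊕ Fin dx) ℝ}
    (hMb : SolvesRiccati β m.A m.B (m.Q + m.P + m.H) m.R Mb)
    (hMbar : SolvesRiccati β m.Abar m.Bbar m.Qbar m.Rbar Mbar) :
    m.IsOptimal μ β x₁ w (linearStrategy n (riccatiGain β m.A m.B m.R Mb)
      (riccatiGain β m.Abar m.Bbar m.Rbar Mbar)) := by
  intro g'
  set g := linearStrategy n (riccatiGain β m.A m.B m.R Mb)
    (riccatiGain β m.Abar m.Bbar m.Rbar Mbar) with hg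
  by_cases hfin : m.cost μ β x₁ w g' = ∞
  · rw [hfin]; exact le_top
  have hRbar := Rbar_posDef m hR0 hR
  have hn0 : (0 : ℝ) < n := by exact_mod_cast hn
  have hc0 : ∀ (g : Strategy n dx du) t ω, 0 ≤ randomStageCost m g x₁ w t ω := fun g t ω =>
    stageCost_nonneg hn hQ hQbar hR0 hR _ _
  have hLd : ∀ i t x, deviation n du i (g.action t x) = _ := fun i t x =>
    deviation_action_linearStrategy _ _ hn t i x
  have hLp : ∀ t x, leaderMean n du (g.action t x) = _ := fun t x =>
    leaderMean_action_linearStrategy _ _ hn t x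
  have hd := fun i => h.isNoisyRun m g (deviation n dx i) (deviation n du i)
    (deviation_step m hn i) (h.memLp_action_of_feedback m g _ _ (deviation_step m hn i) _ (hLd i))
  have hp := h.isNoisyRun m g (leaderMean n dx) (leaderMean n du) (leaderMean_step m hn)
    (h.memLp_action_of_feedback m g _ _ (leaderMean_step m hn) _ hLp)
  have hint := fun t => h.integrable_randomStageCost_of_cost_ne_top hβ (hc0 g') hfin t
  have hd' := fun i => h.isNoisyRun m g' (deviation n dx i) (deviation n du i)
    (deviation_step m hn i) fun t => by
      refine memLp_two_of_qform_le hR ((deviation n du i).continuous_of_finiteDimensional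
        |>.measurable.comp (h.measurable_randomAction m g' t)) ((hint t).const_mul (n : ℝ))
        fun ω => ?_
      have h1 := Finset.single_le_sum (f := fun i =>
        qform (m.Q + m.P + m.H) (deviation n dx i (randomState m g' x₁ w t ω))
          + qform m.R (deviation n du i (randomAction m g' x₁ w t ω)))
        (fun i _ => add_nonneg (qform_nonneg hQ _) (qform_nonneg hR.posSemidef _))
        (Finset.mem_univ i)
      have h2 := qform_nonneg hQ (deviation n dx i (randomState m g' x₁ w t ω))
      have h3 := mul_nonneg hn0.le
        (add_nonneg (qform_nonneg hQbar (leaderMean n dx (randomState m g' x₁ w t ω)))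
          (qform_nonneg hRbar.posSemidef (leaderMean n du (randomAction m g' x₁ w t ω))))
      rw [randomStageCost, stageCost_eq m hn, mul_add, mul_inv_cancel_left₀ hn0.ne']
      linarith
  have hp' := h.isNoisyRun m g' (leaderMean n dx) (leaderMean n du) (leaderMean_step m hn)
    fun t => by
      refine memLp_two_of_qform_le hRbar ((leaderMean n du).continuous_of_finiteDimensional
        |>.measurable.comp (h.measurable_randomAction m g' t)) (hint t) fun ω => ?_
      have h1 : 0 ≤ (n : ℝ)⁻¹ * ∑ i,
          (qform (m.Q + m.P + m.H) (deviation n dx i (randomState m g' x₁ w t ω))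
            + qform m.R (deviation n du i (randomAction m g' x₁ w t ω))) :=
        mul_nonneg (by positivity) (Finset.sum_nonneg fun i _ =>
          add_nonneg (qform_nonneg hQ _) (qform_nonneg hR.posSemidef _))
      have h2 := qform_nonneg hQbar (leaderMean n dx (randomState m g' x₁ w t ω))
      rw [randomStageCost, stageCost_eq m hn]
      linarith
  have hI := integral_randomStageCost hn hd hp
  have hI' := integral_randomStageCost hn hd' hp'
  rw [h.cost_eq_tsum g, ENNReal.tsum_eq_iSup_nat]
  refine iSup_le fun T => ?_
  rw [sum_lintegral_eq_ofReal hβ (fun t => (hI t).1) (hc0 g)]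
  refine ENNReal.ofReal_le_of_le_toReal ?_
  have hsplit : ∀ (N : ℕ) (f : Fin n → ℕ → ℝ) (f' : ℕ → ℝ),
      ∑ t ∈ Finset.range N, β ^ t * ((n : ℝ)⁻¹ * ∑ i, f i t + f' t) =
        (n : ℝ)⁻¹ * ∑ i, ∑ t ∈ Finset.range N, β ^ t * f i t
          + ∑ t ∈ Finset.range N, β ^ t * f' t := by
    intro N f f'
    rw [Finset.sum_comm, Finset.mul_sum, ← Finset.sum_add_distrib]
    refine Finset.sum_congr rfl fun t _ => ?_
    rw [← Finset.mul_sum]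
    ring
  have hcost' : ∀ N, ∑ t ∈ Finset.range N, β ^ t * ∫ ω, randomStageCost m g' x₁ w t ω ∂μ ≤
      (m.cost μ β x₁ w g').toReal := by
    intro N
    rw [← ENNReal.ofReal_le_iff_le_toReal hfin, ← sum_lintegral_eq_ofReal hβ hint (hc0 g'),
      h.cost_eq_tsum]
    exact ENNReal.sum_le_tsum _
  choose a l ha hl hal using fun i => (hd i).exists_tendsto_le_sum_integral_cost (hd' i) rfl hβ hQ
    hR hstab hdet hMb (fun t ω => hLd i t _) T
  obtain ⟨b, k, hb, hk, hbk⟩ := hp.exists_tendsto_le_sum_integral_cost hp' rfl hβ hQbar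
    hRbar hstabbar hdetbar hMbar (fun t ω => hLp t _) T
  simp only [(hI _).2, hsplit]
  refine (add_le_add (mul_le_mul_of_nonneg_left (Finset.sum_le_sum fun i _ => hl i)
    (by positivity)) hk).trans ?_
  refine le_of_tendsto (((tendsto_finsetSum _ fun i _ => ha i).const_mul _).add hb)
    ((eventually_ge_atTop T).mono fun N hN => le_trans ?_ (hcost' N))
  simp only [(hI' _).2, hsplit]
  exact add_le_add (mul_le_mul_of_nonneg_left (Finset.sum_le_sum fun i _ => hal i N hN)
    (by positivity)) (hbk N hN)

end Cost

end LeaderFollower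

open LeaderFollower in
theorem theorem2 {n dx du : ℕ} (hn : 0 < n) (m : Model dx du)
    (β : ℝ) (hβ0 : 0 < β) (hβ1 : β ≤ 1)
    {Ω : Type*} [MeasurableSpace Ω] (μ : Measure Ω) [IsProbabilityMeasure μ]
    (x₁ : Ω → Joint n dx) (w : ℕ → Ω → Joint n dx)
    -- square-integrable initial states, centred square-integrable noise, independence in time
    (hx₁ : Measurable x₁) (hw : ∀ t, Measurable (w t))
    (hx₁2 : MemLp x₁ 2 μ) (hw2 : ∀ t, MemLp (w t) 2 μ) (hw0 : ∀ t, ∫ ω, w t ω ∂μ = 0)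
    (hindep : iIndepFun (primitives x₁ w) μ)
    -- definiteness of the weights (this includes their symmetry)
    (hQ : (m.Q + m.P + m.H).PosSemidef) (hQbar : m.Qbar.PosSemidef)
    (hR0 : m.R0.PosDef) (hR : m.R.PosDef)
    -- stabilizability and detectability
    (hstab : Stabilizable (√β • m.A) (√β • m.B))
    (hstabbar : Stabilizable (√β • m.Abar) (√β • m.Bbar))
    (hdet : Detectable (√β • m.A) (CFC.sqrt (m.Q + m.P + m.H)))
    (hdetbar : Detectable (√β • m.Abar) (CFC.sqrt m.Qbar)) :
    (∃ Mb, SolvesRiccati β m.A m.B (m.Q + m.P + m.H) m.R Mb) ∧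
    (∃ Mbar, SolvesRiccati β m.Abar m.Bbar m.Qbar m.Rbar Mbar) ∧
    ∀ Mb Mbar, SolvesRiccati β m.A m.B (m.Q + m.P + m.H) m.R Mb →
      SolvesRiccati β m.Abar m.Bbar m.Qbar m.Rbar Mbar →
      m.IsOptimal μ β x₁ w
        (linearStrategy n (riccatiGain β m.A m.B m.R Mb)
          (riccatiGain β m.Abar m.Bbar m.Rbar Mbar)) := by
  have h : AdmissiblePrimitives μ x₁ w := ⟨hx₁, hw, hx₁2, hw2, hw0, hindep⟩
  obtain ⟨Mb, hMb, -⟩ := hstab.exists_tendsto_valueIter hβ0 hQ hR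
  obtain ⟨Mbar, hMbar, -⟩ :=
    hstabbar.exists_tendsto_valueIter hβ0 hQbar (Rbar_posDef m hR0 hR)
  exact ⟨⟨Mb, hMb⟩, ⟨Mbar, hMbar⟩, fun _ _ h1 h2 => h.isOptimal_linearStrategy hn hβ0 hQ hQbar hR0
    hR hstab hstabbar hdet hdetbar h1 h2⟩
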